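/- Let $M$ be a connected (Hausdorff) smooth manifold of finite dimension $n$, let $\nabla$ be a smooth symmetric (torsion-free) linear connection on $M$, and let $\hbar$ be a nonzero real number. Let $C^\infty(M)$ be the algebra of smooth complex-valued functions on $M$ and, for $x\in M$, let $\mathfrak m_x\subset C^\infty(M)$ be the ideal of functions vanishing at $x$. A linear differential operator on $C^\infty(M)$ is a $\mathbb C$-linear map $P\colon C^\infty(M)\to C^\infty(M)$ for which there is an $r\ge 0$ with $P(\mathfrak m_x^{r+1})\subseteq\mathfrak m_x$ for all $x\in M$. For a smooth symmetric contravariant tensor field $\Phi=\Phi_r+\cdots+\Phi_0$ on $M$ with complex coefficients ($\Phi_k$ homogeneous of order $k$), an operator $P$ is called the quantized of $\Phi$ if $$P f=\sum_{k=0}^r(-i\hbar)^k\langle\Phi_k,\nabla^k_{\mathrm{sym}}f\rangle\qquad\text{for all } f\in C^\infty(M),$$ where $\nabla^k_{\mathrm{sym}}f$ is the symmetrization of the $k$-th iterated covariant differential of $f$ and $\langle\,,\,\rangle$ is tensor contraction. The function on $T^*M$ corresponding to $\Phi$ is $F_\Phi(p)=\sum_k\Phi_k(p,\dots,p)$. Let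 $\theta$ be the Liouville form of $T^*M$ and $\omega_2=d\theta$ its canonical symplectic form; the Hamiltonian field of a smooth function $F\colon T^*M\to\mathbb C$ is the (complex) vector field $D_F$ on $T^*M$ with $D_F\lrcorner\,\omega_2+dF=0$. Then: 1. Every linear differential operator $P$ on $C^\infty(M)$ is the quantized of exactly one symmetric contravariant tensor field $\Phi$ (not necessarily homogeneous). The function $F_\Phi$ is called the Hamiltonian of $P$, and $D_P:=D_{F_\Phi}$ the Hamiltonian field associated with $P$. 2. The assignment $P\mapsto D_P$ induces a bijection between the linear differential operators on $C^\infty(M)$, taken modulo the addition of operators $f\mapsto cf$ with $c\in\mathbb C$ constant, and the infinitesimal canonical transformations of $T^*M$ that correspond to functions polynomial along the fibres, i.e. the Hamiltonian fields $D_F$ of the smooth functions $F\colon T^*M\to\mathbb C$ for which there is a $d\ge 0$ such that $F$ restricted to each fibre $T^*_xM$ is a polynomial function of degree at most $d$. -/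

import Mathlib

set_option maxSynthPendingDepth 3

open scoped Manifold ContDiff Bundle TensorProduct

noncomputable section

namespace Quantization

variable (n : ℕ) (M : Type*) [TopologicalSpace M] [ChartedSpace (EuclideanSpace ℝ (Fin n)) M]

/-! ### Smooth complex functions and linear differential operators -/

/-- The `ℂ`-algebra `C^∞(M)` of smooth complex valued functions on `M`. -/
def smoothFunctions : Subalgebra ℂ (M → ℂ) where
  carrier := {f | ContMDiff (𝓡 n) 𝓘(ℝ, ℂ) ∞ f}
  mul_mem' {f g} hf hg := by
    have h : ContDiff ℝ ∞ (fun z : ℂ × ℂ => z.1 * z.2) := contDiff_fst.mul contDiff_snd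
    exact h.contMDiff.comp (hf.prodMk_space hg)
  add_mem' {f g} hf hg := by
    have h : ContDiff ℝ ∞ (fun z : ℂ × ℂ => z.1 + z.2) := contDiff_fst.add contDiff_snd
    exact h.contMDiff.comp (hf.prodMk_space hg)
  algebraMap_mem' c := contMDiff_const

/-- The type of smooth complex valued functions on `M`. -/
def SmoothFun : Type _ := smoothFunctions n M

instance : CommRing (SmoothFun n M) := inferInstanceAs (CommRing (smoothFunctions n M))

instance : Algebra ℂ (SmoothFun n M) := inferInstanceAs (Algebra ℂ (smoothFunctions n M))

instance : CoeFun (SmoothFun n M) (fun _ => M → ℂ) := ⟨fun f => Subtype.val f⟩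

variable {n M} in
theorem SmoothFun.zero_apply (x : M) : (0 : SmoothFun n M) x = 0 := rfl

variable {n M} in
theorem SmoothFun.add_apply (f g : SmoothFun n M) (x : M) : (f + g) x = f x + g x := rfl

variable {n M} in
theorem SmoothFun.mul_apply (f g : SmoothFun n M) (x : M) : (f * g) x = f x * g x := rfl

variable {n M} in
theorem SmoothFun.smul_apply (c : ℂ) (f : SmoothFun n M) (x : M) : (c • f) x = c * f x := rfl

variable {M} in
/-- The ideal `𝔪_x` of the smooth functions that vanish at `x`. -/
def vanishingIdeal (x : M) : Ideal (SmoothFun n M) where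
  carrier := {f | f x = 0}
  zero_mem' := rfl
  add_mem' {f g} hf hg := by
    have hf' : f x = 0 := hf
    have hg' : g x = 0 := hg
    show (f + g) x = 0
    rw [SmoothFun.add_apply, hf', hg', add_zero]
  smul_mem' c f hf := by
    have hf' : f x = 0 := hf
    show (c * f) x = 0
    rw [SmoothFun.mul_apply, hf', mul_zero]

/-- The linear differential operators on `C^∞(M)`: the `ℂ`-linear maps `P` such that, for some
order `r`, `P` maps `𝔪_x ^ (r + 1)` into `𝔪_x` for all points `x`. -/
def diffOp : Submodule ℂ (SmoothFun n M →ₗ[ℂ] SmoothFun n M) where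
  carrier := {P | ∃ r : ℕ, ∀ x : M, ∀ f ∈ vanishingIdeal n x ^ (r + 1), P f ∈ vanishingIdeal n x}
  zero_mem' := ⟨0, fun x _ _ => (vanishingIdeal n x).zero_mem⟩
  add_mem' := by
    rintro P Q ⟨r, hr⟩ ⟨s, hs⟩
    refine ⟨max r s, fun x f hf => (vanishingIdeal n x).add_mem (hr x f ?_) (hs x f ?_)⟩
    · exact Ideal.pow_le_pow_right (by omega) hf
    · exact Ideal.pow_le_pow_right (by omega) hf
  smul_mem' := by
    rintro c P ⟨r, hr⟩
    refine ⟨r, fun x f hf => ?_⟩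
    have h : P f x = 0 := hr x f hf
    show (c • P f) x = 0
    rw [SmoothFun.smul_apply, h, mul_zero]

/-- The operators `f ↦ c f` with `c` a complex constant, among the differential operators. -/
def constantOp : Submodule ℂ (diffOp n M) :=
  (Submodule.span ℂ {(LinearMap.id : SmoothFun n M →ₗ[ℂ] SmoothFun n M)}).submoduleOf (diffOp n M)

/-! ### The cotangent bundle and symmetric contravariant tensor fields -/

/-- The cotangent space `T_x^*M`, as fibre of Mathlib's bundle of homomorphisms from the tangent
bundle to the trivial line bundle. -/
abbrev Cotangent (x : M) : Type := TangentSpace (𝓡 n) x →L[ℝ] Bundle.Trivial M ℝ x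

/-- The cotangent bundle `T^*M`, a smooth manifold modelled on `ℝⁿ × (ℝⁿ)^*`. -/
abbrev CotangentBundle : Type _ :=
  Bundle.TotalSpace (EuclideanSpace ℝ (Fin n) →L[ℝ] ℝ) (Cotangent n M)

/-- The model space of `T^*M`. -/
abbrev CotangentModel : Type := EuclideanSpace ℝ (Fin n) × (EuclideanSpace ℝ (Fin n) →L[ℝ] ℝ)

/-- The model with corners of `T^*M`. -/
abbrev cotangentModel := (𝓡 n).prod 𝓘(ℝ, EuclideanSpace ℝ (Fin n) →L[ℝ] ℝ)

/-- The differential at `x` of a real function on `M`, as an element of `T_x^*M`. -/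
def differential {M : Type*} [TopologicalSpace M] [ChartedSpace (EuclideanSpace ℝ (Fin n)) M]
    (f : M → ℝ) (x : M) : Cotangent n M x :=
  mvfderiv (𝓡 n) f x

/-- Homogeneous symmetric contravariant tensor fields of order `r` on `M`, smooth and with complex
coefficients. The value at `x` is a symmetric `r`-linear map `T_x^*M × ⋯ × T_x^*M → ℂ`, that is, an
element of `ℂ ⊗ Sym^r(T_xM)`. Since the differentials of global smooth functions
provide local coframes, the last condition says that the components in charts are smooth. -/
def symTensor (r : ℕ) :
    Submodule ℂ (∀ x : M, MultilinearMap ℝ (fun _ : Fin r => Cotangent n M x) ℂ) where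
  carrier := {Φ |
    (∀ (x : M) (σ : Equiv.Perm (Fin r)) (ξ : Fin r → Cotangent n M x),
      Φ x (fun i => ξ (σ i)) = Φ x ξ) ∧
    ∀ f : Fin r → M → ℝ, (∀ i, ContMDiff (𝓡 n) 𝓘(ℝ, ℝ) ∞ (f i)) →
      ContMDiff (𝓡 n) 𝓘(ℝ, ℂ) ∞ (fun x => Φ x (fun i => differential n (f i) x))}
  zero_mem' := ⟨fun _ _ _ => rfl, fun _ _ => contMDiff_const⟩
  add_mem' := by
    rintro Φ Ψ ⟨h1, h2⟩ ⟨h3, h4⟩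
    exact ⟨fun x σ ξ => congrArg₂ (· + ·) (h1 x σ ξ) (h3 x σ ξ),
      fun f hf => (smoothFunctions n M).add_mem (h2 f hf) (h4 f hf)⟩
  smul_mem' := by
    rintro c Φ ⟨h1, h2⟩
    exact ⟨fun x σ ξ => congrArg (c • ·) (h1 x σ ξ),
      fun f hf => (smoothFunctions n M).smul_mem (h2 f hf) c⟩

/-- Symmetric contravariant tensor fields on `M`, not necessarily homogeneous: finite sums
`Φ = Φ_r + ⋯ + Φ_0` of homogeneous ones. -/
abbrev SymTensor : Type _ := Π₀ r : ℕ, symTensor n M r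

open Classical in
/-- The function on `T^*M` that corresponds to the tensor field `Φ`; its value at `p ∈ T_x^*M` is
`∑ r, Φ_r(p, …, p)`. -/
def fibreFunction {n : ℕ} {M : Type*} [TopologicalSpace M]
    [ChartedSpace (EuclideanSpace ℝ (Fin n)) M] (Φ : SymTensor n M) (p : CotangentBundle n M) : ℂ :=
  ∑ r ∈ Φ.support, (Φ r).1 p.proj (fun _ => p.2)

/-! ### Quantization by a linear connection -/

section Connection

variable {n} {M} [IsManifold (𝓡 n) ∞ M]

variable (n M) in
/-- Linear connections on `M`. -/
abbrev LinearConnection : Type _ :=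
  CovariantDerivative (𝓡 n) (EuclideanSpace ℝ (Fin n)) (TangentSpace (𝓡 n) : M → Type)

/-- The iterated covariant differential of a complex function, evaluated on vector fields:
`∇⁰f = f` and
`(∇^{r+1}f)(X₀, X₁, …, X_r) = X₀((∇^r f)(X₁, …, X_r)) - ∑ j, (∇^r f)(X₁, …, ∇_{X₀}X_j, …, X_r)`. -/
def iteratedCov (cov : LinearConnection n M) (f : M → ℂ) :
    (r : ℕ) → (Fin r → ∀ x : M, TangentSpace (𝓡 n) x) → M → ℂ
  | 0, _, x => f x
  | r + 1, X, x =>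
      mvfderiv (𝓡 n) (iteratedCov cov f r (Fin.tail X)) x (X 0 x) -
        ∑ j : Fin r, iteratedCov cov f r
          (Function.update (Fin.tail X) j (fun y => cov (X j.succ) y (X 0 y))) x

/-- The covariant tensor `∇^r f` at `x`, evaluated on tangent vectors at `x`, which are extended to
vector fields that are smooth near `x`. -/
def iteratedCovAt (cov : LinearConnection n M)
    (f : M → ℂ) (r : ℕ) (x : M) (v : Fin r → TangentSpace (𝓡 n) x) : ℂ :=
  iteratedCov cov f r (fun i => FiberBundle.extend (EuclideanSpace ℝ (Fin n)) (v i)) x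

/-- The symmetrized tensor `∇^r_sym f` at `x`. -/
def symCovAt (cov : LinearConnection n M)
    (f : M → ℂ) (r : ℕ) (x : M) (v : Fin r → TangentSpace (𝓡 n) x) : ℂ :=
  (r.factorial : ℂ)⁻¹ * ∑ σ : Equiv.Perm (Fin r), iteratedCovAt cov f r x (fun i => v (σ i))

/-- The standard basis of the model space `ℝⁿ` as a basis of the tangent space `T_xM`. -/
def tangentBasis (x : M) : Module.Basis (Fin n) ℝ (TangentSpace (𝓡 n) x) :=
  (EuclideanSpace.basisFun (Fin n) ℝ).toBasis

/-- The basis of `T_x^*M` dual to `tangentBasis x`. -/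
def dualBasis (x : M) (i : Fin n) : Cotangent n M x :=
  LinearMap.toContinuousLinearMap (𝕜 := ℝ) (E := EuclideanSpace ℝ (Fin n)) (F' := ℝ)
    ((tangentBasis x).coord i)

/-- The contraction `⟨A, B⟩ = ∑ A^{i₁ ⋯ i_r} B_{i₁ ⋯ i_r}` of a contravariant tensor `A` with a
covariant tensor `B` at the point `x`; it does not depend on the basis of `T_xM`. -/
def contraction {r : ℕ} {x : M} (A : MultilinearMap ℝ (fun _ : Fin r => Cotangent n M x) ℂ)
    (B : (Fin r → TangentSpace (𝓡 n) x) → ℂ) : ℂ :=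
  ∑ i : Fin r → Fin n, A (fun k => dualBasis x (i k)) * B (fun k => tangentBasis x (i k))

open Classical in
/-- `P` is the quantized `Φ̂` of the tensor field `Φ`:
`P f = ∑ r, (-iħ)^r ⟨Φ_r, ∇^r_sym f⟩` for all smooth `f`. -/
def IsQuantized (ħ : ℝ) (cov : LinearConnection n M)
    (Φ : SymTensor n M) (P : SmoothFun n M →ₗ[ℂ] SmoothFun n M) : Prop :=
  ∀ (f : SmoothFun n M) (x : M),
    P f x =
      ∑ r ∈ Φ.support, (-Complex.I * ħ) ^ r * contraction ((Φ r).1 x) (symCovAt cov f r x)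

end Connection

/-! ### The symplectic structure of the cotangent bundle -/

section Symplectic

variable {n} {M} [IsManifold (𝓡 n) ∞ M]

/-- The exterior derivative of a `1`-form `η` on a manifold without boundary,
`dη(v, w) = ∂_v(η(w)) - ∂_w(η(v))` in the preferred chart at the point `y`. -/
def extDerivOneForm {E H N : Type*} [NormedAddCommGroup E] [NormedSpace ℝ E] [TopologicalSpace H]
    (J : ModelWithCorners ℝ E H) [TopologicalSpace N] [ChartedSpace H N]
    (η : ∀ y : N, TangentSpace J y →L[ℝ] ℝ) (y : N) :
    TangentSpace J y →ₗ[ℝ] TangentSpace J y →ₗ[ℝ] ℝ :=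
  let localForm : E → (E →L[ℝ] ℝ) := fun z =>
    (η ((extChartAt J y).symm z)).comp (mfderiv 𝓘(ℝ, E) J (extChartAt J y).symm z)
  let A : E →L[ℝ] E →L[ℝ] ℝ := fderiv ℝ localForm (extChartAt J y y)
  let φ : TangentSpace J y →ₗ[ℝ] E := (mfderiv J 𝓘(ℝ, E) (extChartAt J y) y).toLinearMap
  LinearMap.mk₂ ℝ (fun v w => A (φ v) (φ w) - A (φ w) (φ v))
    (fun _ _ _ => by simp; ring) (fun _ _ _ => by simp; ring)
    (fun _ _ _ => by simp; ring) (fun _ _ _ => by simp; ring)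

/-- The Liouville form `θ` of `T^*M`, `θ_p(w) = p(π_* w)`. -/
def liouville (p : CotangentBundle n M) : TangentSpace (cotangentModel n) p →L[ℝ] ℝ :=
  ContinuousLinearMap.comp (p.2 : TangentSpace (𝓡 n) p.proj →L[ℝ] ℝ)
    (mfderiv (cotangentModel n) (𝓡 n)
      (Bundle.TotalSpace.proj : CotangentBundle n M → M) p)

/-- The canonical symplectic form `ω₂ = dθ` of `T^*M`. -/
def symplecticForm (p : CotangentBundle n M) :
    TangentSpace (cotangentModel n) p →ₗ[ℝ] TangentSpace (cotangentModel n) p →ₗ[ℝ] ℝ :=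
  extDerivOneForm (cotangentModel n) liouville p

variable (n M) in
/-- Complex tangent vector fields on `T^*M`: sections of `ℂ ⊗ T(T^*M)`. -/
abbrev ComplexField : Type _ :=
  ∀ p : CotangentBundle n M, ℂ ⊗[ℝ] TangentSpace (cotangentModel n) p

/-- The interior product `D ⌟ ω₂`, evaluated on the tangent vector `w` at `p`; it is the complex
linear extension of `v ↦ ω₂(v, w)` to `v ∈ ℂ ⊗ T_p(T^*M)`. -/
def interior (D : ComplexField n M) (p : CotangentBundle n M)
    (w : TangentSpace (cotangentModel n) p) : ℂ :=
  TensorProduct.rid ℝ ℂ (((symplecticForm p).flip w).baseChange ℂ (D p))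

/-- `D` is the Hamiltonian vector field of the function `F` on `T^*M`: `D ⌟ ω₂ + dF = 0`. As `ω₂`
is nondegenerate, this determines `D`, and `D` is smooth if `F` is. -/
def IsHamiltonianField (F : CotangentBundle n M → ℂ) (D : ComplexField n M) : Prop :=
  ∀ (p : CotangentBundle n M) (w : TangentSpace (cotangentModel n) p),
    interior D p w + mvfderiv (cotangentModel n) F p w = 0

/-- `F` is a smooth complex function on `T^*M` that is polynomial along the fibres: for some `d`, it
is on each fibre `T_x^*M` a polynomial function of degree at most `d` with complex coefficients,
that is, a sum of homogeneous ones `ξ ↦ A(ξ, …, ξ)` with `A` multilinear. -/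
def IsFibrePolynomial (F : CotangentBundle n M → ℂ) : Prop :=
  ContMDiff (cotangentModel n) 𝓘(ℝ, ℂ) ∞ F ∧
  ∃ d : ℕ, ∀ x : M, ∃ A : ∀ k : ℕ, MultilinearMap ℝ (fun _ : Fin k => Cotangent n M x) ℂ,
    ∀ ξ : Cotangent n M x, F ⟨x, ξ⟩ = ∑ k ∈ Finset.range (d + 1), A k (fun _ => ξ)

variable (n M) in
/-- The infinitesimal canonical transformations of `T^*M` that correspond to functions which are
polynomial along the fibres. -/
def polynomialHamiltonianFields : Set (ComplexField n M) :=
  {D | ∃ F : CotangentBundle n M → ℂ, IsFibrePolynomial F ∧ IsHamiltonianField F D}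

/-- `D` is the Hamiltonian field associated with the operator `P` by the connection `cov`: it is the
Hamiltonian field of the function on `T^*M` given by the tensor field whose quantized is `P`. -/
def IsAssociatedField (ħ : ℝ) (cov : LinearConnection n M)
    (P : SmoothFun n M →ₗ[ℂ] SmoothFun n M) (D : ComplexField n M) : Prop :=
  ∃ Φ : SymTensor n M, IsQuantized ħ cov Φ P ∧ IsHamiltonianField (fibreFunction Φ) D

end Symplectic

end Quantization

end

/-!
The operator obtained by quantizing a homogeneous tensor field `Φ_r` has order `r` and principal
symbol `r! (-iħ)^r Φ_r`: on a product of `r` functions vanishing at `x`, the symmetrized `r`-th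
covariant differential is the symmetrized product of their differentials, and on a product of more
than `r` such functions it vanishes. Conversely, the symbol of an operator of order `r` is a smooth
symmetric tensor field, so subtracting the quantization of its multiple by `(r! (-iħ)^r)⁻¹` lowers
the order. Induction on the order gives existence and uniqueness of `Φ`.

By polarization, `Φ ↦ F_Φ` is a bijection onto the smooth functions that are polynomial along the
fibres; the homogeneous parts of such a function are combinations of its dilations `p ↦ F(t p)`.
In the bundle charts of `T^*M` the symplectic form is `v.2 w.1 - w.2 v.1`, hence nondegenerate, so
that `D_F` exists and determines `dF`, and therefore `F` up to a constant since `T^*M` is connected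
with `M`. As constants correspond to tensor fields of order zero with constant coefficient, that is,
to the operators `f ↦ c f`, the assignment `P ↦ D_P` descends to a bijection.
-/

noncomputable section

namespace Quantization

/-! ### Multilinear algebra and powers of ideals -/

section Polarization

theorem sum_neg_one_pow_card_compl_of_subset {ι : Type*} [Fintype ι] [DecidableEq ι]
    (T : Finset ι) :
    ∑ S : Finset ι, (if T ⊆ S then (-1 : ℤ) ^ Sᶜ.card else 0) =
      if T = Finset.univ then 1 else 0 := by
  calc ∑ S : Finset ι, (if T ⊆ S then (-1 : ℤ) ^ Sᶜ.card else 0)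
      = ∑ U ∈ Tᶜ.powerset, (-1 : ℤ) ^ U.card := by
        rw [← Finset.sum_filter]
        refine Finset.sum_bij' (fun S _ => Sᶜ) (fun U _ => Uᶜ) ?_ ?_ ?_ ?_ ?_
        · simp
        · exact fun U hU => by simpa using Finset.subset_compl_comm.1 (Finset.mem_powerset.1 hU)
        all_goals simp
    _ = if T = Finset.univ then 1 else 0 := by
        simp only [Finset.sum_powerset_neg_one_pow_card, Finset.compl_eq_empty_iff]

theorem image_univ_eq_univ_iff_bijective {ι : Type*} [Fintype ι] [DecidableEq ι] (I : ι → ι) :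
    Finset.univ.image I = Finset.univ ↔ Function.Bijective I := by
  rw [← Finite.surjective_iff_bijective, ← Finset.coe_inj]
  simp [Set.range_eq_univ]

variable {R V W ι : Type*} [CommRing R] [AddCommGroup V] [Module R V] [AddCommGroup W] [Module R W]

theorem polarization [Fintype ι] [DecidableEq ι] (f : MultilinearMap R (fun _ : ι => V) W)
    (hf : ∀ (σ : Equiv.Perm ι) (v : ι → V), f (fun i => v (σ i)) = f v) (v : ι → V) :
    ∑ S : Finset ι, (-1 : ℤ) ^ Sᶜ.card • f (fun _ => ∑ i ∈ S, v i) =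
      (Fintype.card ι).factorial • f v := by
  have expand (S : Finset ι) : (-1 : ℤ) ^ Sᶜ.card • f (fun _ => ∑ i ∈ S, v i) =
      ∑ I : ι → ι, (if Finset.univ.image I ⊆ S then (-1 : ℤ) ^ Sᶜ.card else 0) •
        f (fun k => v (I k)) := by
    rw [f.map_sum_finset (fun _ j => v j) (fun _ => S), Finset.smul_sum]
    simp only [ite_smul, zero_smul]
    rw [← Finset.sum_filter]
    refine Finset.sum_congr ?_ fun _ _ => rfl
    ext I
    simp [Finset.image_subset_iff]
  calc ∑ S : Finset ι, (-1 : ℤ) ^ Sᶜ.card • f (fun _ => ∑ i ∈ S, v i)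
      = ∑ I : ι → ι, (if Function.Bijective I then (1 : ℤ) else 0) • f (fun k => v (I k)) := by
        simp only [expand]
        rw [Finset.sum_comm]
        simp only [← Finset.sum_smul, sum_neg_one_pow_card_compl_of_subset,
          image_univ_eq_univ_iff_bijective]
    _ = ∑ σ : Equiv.Perm ι, f (fun k => v (σ k)) := by
        refine (Fintype.sum_of_injective (fun σ : Equiv.Perm ι => ⇑σ) DFunLike.coe_injective _ _
          (fun I hI => ?_) fun σ => ?_).symm
        · rw [if_neg fun h => hI ⟨Equiv.ofBijective I h, rfl⟩, zero_smul]
        · rw [if_pos σ.bijective, one_smul]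
    _ = (Fintype.card ι).factorial • f v := by
        simp only [hf, Finset.sum_const, Finset.card_univ, Fintype.card_perm]

theorem eq_zero_of_diagonal_eq_zero [Finite ι] [Module ℚ W]
    (f : MultilinearMap R (fun _ : ι => V) W)
    (hf : ∀ (σ : Equiv.Perm ι) (v : ι → V), f (fun i => v (σ i)) = f v)
    (hdiag : ∀ v, f (fun _ => v) = 0) (v : ι → V) : f v = 0 := by
  classical
  have := Fintype.ofFinite ι
  have hzero : ((Fintype.card ι).factorial : ℚ) • f v = 0 := by
    rw [Nat.cast_smul_eq_nsmul, ← polarization f hf v]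
    simp only [hdiag, smul_zero, Finset.sum_const_zero]
  exact (smul_eq_zero.1 hzero).resolve_left (Nat.cast_ne_zero.2 (Nat.factorial_ne_zero _))

end Polarization

section IdealPowers

theorem prod_mem_pow {A : Type*} [CommRing A] {I : Ideal A} {s : ℕ} {F : Fin s → A}
    (hF : ∀ i, F i ∈ I) : ∏ i, F i ∈ I ^ s := by
  simpa using Ideal.prod_mem_prod (s := Finset.univ) (I := fun _ : Fin s => I) fun i _ => hF i

theorem prod_sub_prod_mem_pow {A : Type*} [CommRing A] {I : Ideal A} {r : ℕ} {a b : Fin r → A}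
    (ha : ∀ i, a i ∈ I) (hb : ∀ i, b i ∈ I) (hab : ∀ i, a i - b i ∈ I ^ 2) :
    ∏ i, a i - ∏ i, b i ∈ I ^ (r + 1) := by
  induction r with
  | zero => simp
  | succ r ih =>
    have telescope : ∏ i, a i - ∏ i, b i = (∏ i : Fin r, a i.succ) * (a 0 - b 0) +
        b 0 * (∏ i : Fin r, a i.succ - ∏ i : Fin r, b i.succ) := by
      rw [Fin.prod_univ_succ, Fin.prod_univ_succ]
      ring
    rw [telescope]
    refine Ideal.add_mem _ ?_ ?_
    · rw [add_assoc, pow_add]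
      exact Ideal.mul_mem_mul (prod_mem_pow fun i => ha i.succ) (hab 0)
    · rw [pow_succ']
      exact Ideal.mul_mem_mul (hb 0)
        (ih (fun i => ha i.succ) (fun i => hb i.succ) fun i => hab i.succ)

variable {k A W : Type*} [CommRing k] [CommRing A] [Algebra k A] [AddCommGroup W] [Module k W]
  {I : Ideal A} {L : A →ₗ[k] W} {s : ℕ}

open scoped Pointwise in
theorem map_eq_zero_of_mem_pow (h : ∀ (a : A) (F : Fin s → A), (∀ i, F i ∈ I) →
    L (a * ∏ i, F i) = 0) {f : A} (hf : f ∈ I ^ s) : L f = 0 := by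
  suffices H : ∀ a, L (a * f) = 0 by simpa using H 1
  rw [show I ^ s = Submodule.span A ((I : Set A) ^ s) from Submodule.pow_eq_span_pow_set I s] at hf
  induction hf using Submodule.span_induction with
  | mem x hx =>
    intro a
    obtain ⟨F, rfl⟩ := Set.mem_pow.1 hx
    rw [List.prod_ofFn]
    exact h a _ fun i => (F i).2
  | zero => simp
  | add x y _ _ hx hy => intro a; rw [mul_add, map_add, hx, hy, add_zero]
  | smul b x _ hx => intro a; rw [smul_eq_mul, ← mul_assoc]; exact hx _

variable [Module ℚ W]

theorem map_prod_eq_zero_of_map_pow_eq_zero (h : ∀ g ∈ I, L (g ^ s) = 0) {F : Fin s → A}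
    (hF : ∀ i, F i ∈ I) : L (∏ i, F i) = 0 := by
  let f : MultilinearMap k (fun _ : Fin s => I.restrictScalars k) W :=
    L.compMultilinearMap ((MultilinearMap.mkPiAlgebra k (Fin s) A).compLinearMap
      fun _ => (I.restrictScalars k).subtype)
  have f_apply (v) : f v = L (∏ i, (v i : A)) := rfl
  rw [← f_apply fun i => ⟨F i, hF i⟩]
  refine eq_zero_of_diagonal_eq_zero f (fun σ v => ?_) (fun v => ?_) _
  · rw [f_apply, f_apply, Equiv.prod_comp σ fun i => (v i : A)]
  · rw [f_apply, Finset.prod_const, Finset.card_univ, Fintype.card_fin, h v v.2]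

theorem map_eq_zero_of_map_pow_succ_eq_zero (h : ∀ g ∈ I, L (g ^ (s + 1)) = 0) {f : A}
    (hf : f ∈ I ^ (s + 1)) : L f = 0 := by
  refine map_eq_zero_of_mem_pow (fun a F hF => ?_) hf
  have absorb : a * ∏ i, F i = ∏ i, (Fin.cons (a * F 0) (Fin.tail F) : Fin (s + 1) → A) i := by
    rw [Fin.prod_univ_succ, Fin.prod_univ_succ]
    simp [Fin.tail, mul_assoc]
  rw [absorb]
  exact map_prod_eq_zero_of_map_pow_eq_zero h
    (Fin.cases (I.mul_mem_left a (hF 0)) fun i => hF i.succ)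

theorem map_eq_zero_of_map_pow_eq_zero (hI : ∀ a : A, ∃ c : k, a - algebraMap k A c ∈ I)
    (hpow : ∀ g ∈ I, L (g ^ s) = 0) (hsucc : ∀ f ∈ I ^ (s + 1), L f = 0) {f : A}
    (hf : f ∈ I ^ s) : L f = 0 := by
  refine map_eq_zero_of_mem_pow (fun a F hF => ?_) hf
  obtain ⟨c, hc⟩ := hI a
  have split : a * ∏ i, F i = (a - algebraMap k A c) * ∏ i, F i + c • ∏ i, F i := by
    rw [Algebra.smul_def]
    ring
  rw [split, map_add, map_smul, map_prod_eq_zero_of_map_pow_eq_zero hpow hF, smul_zero, add_zero]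
  refine hsucc _ ?_
  rw [pow_succ']
  exact Ideal.mul_mem_mul hc (prod_mem_pow hF)

end IdealPowers

theorem sum_mul_eq_sum_mul_of_change_of_basis {R S U V ι κ : Type*} [CommSemiring R]
    [CommSemiring S] [Algebra R S] [AddCommMonoid U] [Module R U] [AddCommMonoid V] [Module R V]
    [Fintype ι] [Fintype κ] {r : ℕ} (A : MultilinearMap R (fun _ : Fin r => U) S)
    (B : MultilinearMap R (fun _ : Fin r => V) S) {b : ι → V} {β : ι → U} {c : κ → V} {γ : κ → U}
    (m : κ → ι → R) (hγ : ∀ k, γ k = ∑ i, m k i • β i) (hb : ∀ i, b i = ∑ k, m k i • c k) :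
    ∑ J : Fin r → ι, A (fun l => β (J l)) * B (fun l => b (J l)) =
      ∑ K : Fin r → κ, A (fun l => γ (K l)) * B (fun l => c (K l)) := by
  classical
  simp only [hγ, hb, MultilinearMap.map_sum, MultilinearMap.map_smul_univ, Finset.mul_sum,
    Finset.sum_mul]
  rw [Finset.sum_comm]
  simp only [mul_smul_comm, smul_mul_assoc]

open Polynomial in
theorem coeff_eq_sum_eval_mul_coeff_basis {K ι : Type*} [Field K] [DecidableEq ι] {s : Finset ι}
    {v : ι → K} (hv : Set.InjOn v s) {p : K[X]} (hp : p.degree < s.card) (k : ℕ) :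
    p.coeff k = ∑ i ∈ s, p.eval (v i) * (Lagrange.basis s v i).coeff k := by
  conv_lhs => rw [Lagrange.eq_interpolate hv hp, Lagrange.interpolate_apply, finsetSum_coeff]
  simp only [coeff_C_mul]

open Polynomial in
theorem eq_sum_mul_coeff_basis {K : Type*} [Field K] [CharZero K] {d k : ℕ} (hk : k ≤ d)
    (a : ℕ → K) :
    a k = ∑ t ∈ Finset.range (d + 1), (∑ j ∈ Finset.range (d + 1), a j * (t : K) ^ j) *
      (Lagrange.basis (Finset.range (d + 1)) (Nat.cast : ℕ → K) t).coeff k := by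
  let p : K[X] := ∑ j ∈ Finset.range (d + 1), C (a j) * X ^ j
  have hdeg : p.degree < (Finset.range (d + 1)).card := by
    rw [Finset.card_range]
    exact (degree_lt_iff_coeff_zero _ _).2 fun m hm => by
      simp [p, Nat.not_lt.2 hm]
  have hcoeff : p.coeff k = a k := by
    simp [p, Nat.lt_succ_of_le hk]
  rw [← hcoeff, coeff_eq_sum_eval_mul_coeff_basis Nat.cast_injective.injOn hdeg]
  simp [p, eval_finsetSum]

section Diagonal

variable {R K V : Type*} [CommRing R] [Field K] [Algebra R K] [AddCommGroup V]
  [Module R V]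

variable {k : ℕ}

/-- The average of a multilinear map over the permutations of its arguments: the symmetric
multilinear map with the same diagonal. -/
def symmetrize (A : MultilinearMap R (fun _ : Fin k => V) K) :
    MultilinearMap R (fun _ : Fin k => V) K :=
  (k.factorial : K)⁻¹ • ∑ σ : Equiv.Perm (Fin k), A.domDomCongr σ

theorem symmetrize_apply (A : MultilinearMap R (fun _ : Fin k => V) K) (v : Fin k → V) :
    symmetrize A v = (k.factorial : K)⁻¹ * ∑ σ : Equiv.Perm (Fin k), A fun i => v (σ i) := by
  simp only [symmetrize, smul_apply, sum_apply, MultilinearMap.domDomCongr_apply, smul_eq_mul]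

theorem symmetrize_perm (A : MultilinearMap R (fun _ : Fin k => V) K) (σ : Equiv.Perm (Fin k))
    (v : Fin k → V) : symmetrize A (fun i => v (σ i)) = symmetrize A v := by
  simp only [symmetrize_apply]
  congr 1
  exact Equiv.sum_comp (Equiv.mulLeft σ) fun τ : Equiv.Perm (Fin k) => A fun i => v (τ i)

variable [CharZero K]

theorem symmetrize_diagonal (A : MultilinearMap R (fun _ : Fin k => V) K) (v : V) :
    symmetrize A (fun _ => v) = A fun _ => v := by
  rw [symmetrize_apply, Finset.sum_const, Finset.card_univ, Fintype.card_perm, Fintype.card_fin,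
    nsmul_eq_mul, inv_mul_cancel_left₀ (Nat.cast_ne_zero.2 k.factorial_ne_zero)]

theorem diagonal_eq_sum_mul_coeff_basis {A : ∀ j : ℕ, MultilinearMap R (fun _ : Fin j => V) K}
    {F : V → K} {d : ℕ} (hF : ∀ ξ, F ξ = ∑ j ∈ Finset.range (d + 1), A j (fun _ => ξ))
    (hk : k ≤ d) (ξ : V) :
    A k (fun _ => ξ) = ∑ t ∈ Finset.range (d + 1), F ((t : R) • ξ) *
      (Lagrange.basis (Finset.range (d + 1)) (Nat.cast : ℕ → K) t).coeff k := by
  have homogeneous (j t : ℕ) :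
      A j (fun _ => (t : R) • ξ) = A j (fun _ => ξ) * (t : K) ^ j := by
    rw [(A j).map_smul_univ (fun _ => (t : R)) fun _ => ξ, Finset.prod_const, Finset.card_univ,
      Fintype.card_fin, Algebra.smul_def, map_pow, map_natCast, mul_comm]
  rw [eq_sum_mul_coeff_basis hk fun j => A j fun _ => ξ]
  simp only [hF, homogeneous]

end Diagonal

/-! ### Hadamard's lemma -/

section Hadamard

open MeasureTheory Set Metric

universe u

theorem contDiff_nat_intervalIntegral_param {E : Type u} [NormedAddCommGroup E] [NormedSpace ℝ E]
    [ProperSpace E] (k : ℕ) : ∀ {V : Type u} [NormedAddCommGroup V] [NormedSpace ℝ V]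
    [CompleteSpace V] {G : E × ℝ → V}, ContDiff ℝ k G →
      ContDiff ℝ k (fun u => ∫ t in (0 : ℝ)..1, G (u, t)) := by
  induction k with
  | zero =>
    intro V _ _ _ G hG
    refine contDiff_zero.2 ?_
    exact intervalIntegral.continuous_parametric_intervalIntegral_of_continuous'
      (f := fun u t => G (u, t)) (by simpa [Function.uncurry_def] using hG.continuous) 0 1
  | succ k ih =>
    intro V _ _ _ G hG
    let G' : E × ℝ → E →L[ℝ] V := fun p => (fderiv ℝ G p).comp (ContinuousLinearMap.inl ℝ E ℝ)
    have hG' : ContDiff ℝ k G' := (hG.fderiv_right (by norm_cast)).clm_comp contDiff_const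
    have hderiv (u : E) (t : ℝ) : HasFDerivAt (fun u => G (u, t)) (G' (u, t)) u :=
      (hG.differentiable (by simp) _).hasFDerivAt.comp u (hasFDerivAt_prodMk_left u t)
    have hslice (u : E) : Continuous fun t : ℝ => (u, t) := by fun_prop
    refine contDiff_succ_iff_hasFDerivAt.2
      ⟨fun u => ∫ t in (0 : ℝ)..1, G' (u, t), ih hG', fun u => ?_⟩
    obtain ⟨C, hC⟩ := ((isCompact_closedBall u 1).prod
      (isCompact_Icc (a := (0 : ℝ)) (b := 1))).exists_bound_of_continuousOn
        hG'.continuous.continuousOn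
    refine intervalIntegral.hasFDerivAt_integral_of_dominated_of_fderiv_le
      (F := fun u t => G (u, t)) (F' := fun u t => G' (u, t)) (bound := fun _ => C)
      (closedBall_mem_nhds u one_pos)
      (.of_forall fun v => (hG.continuous.comp (hslice v)).aestronglyMeasurable)
      ((hG.continuous.comp (hslice u)).intervalIntegrable 0 1)
      (hG'.continuous.comp (hslice u)).aestronglyMeasurable
      (.of_forall fun t ht v hv => hC (v, t) ⟨hv, ?_⟩)
      intervalIntegrable_const (.of_forall fun t _ v _ => hderiv v t)
    rw [uIoc_of_le zero_le_one] at ht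
    exact Ioc_subset_Icc_self ht

theorem contDiff_intervalIntegral_param {E V : Type u} [NormedAddCommGroup E] [NormedSpace ℝ E]
    [ProperSpace E] [NormedAddCommGroup V] [NormedSpace ℝ V] [CompleteSpace V] {G : E × ℝ → V}
    (hG : ContDiff ℝ ∞ G) : ContDiff ℝ ∞ (fun u => ∫ t in (0 : ℝ)..1, G (u, t)) :=
  contDiff_infty.2 fun k => contDiff_nat_intervalIntegral_param k (contDiff_infty.1 hG k)

theorem hadamard {E V : Type u} [NormedAddCommGroup E] [NormedSpace ℝ E] [ProperSpace E]
    [NormedAddCommGroup V] [NormedSpace ℝ V] [CompleteSpace V] {F : E → V} (hF : ContDiff ℝ ∞ F)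
    (u₀ : E) :
    ∃ G : E → E →L[ℝ] V, ContDiff ℝ ∞ G ∧ G u₀ = fderiv ℝ F u₀ ∧
      ∀ u, F u = F u₀ + G u (u - u₀) := by
  have hF' : ContDiff ℝ ∞ (fderiv ℝ F) := hF.fderiv_right (by simp)
  refine ⟨fun u => ∫ t in (0 : ℝ)..1, fderiv ℝ F (u₀ + t • (u - u₀)),
    contDiff_intervalIntegral_param (G := fun p => fderiv ℝ F (u₀ + p.2 • (p.1 - u₀)))
      (hF'.comp (contDiff_const.add (contDiff_snd.smul (contDiff_fst.sub contDiff_const)))),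
    by simp, fun u => ?_⟩
  have hcont : Continuous fun t : ℝ => fderiv ℝ F (u₀ + t • (u - u₀)) :=
    hF'.continuous.comp (by fun_prop)
  have hderiv (t : ℝ) : HasDerivAt (fun t : ℝ => F (u₀ + t • (u - u₀)))
      (fderiv ℝ F (u₀ + t • (u - u₀)) (u - u₀)) t := by
    have hline : HasDerivAt (fun t : ℝ => u₀ + t • (u - u₀)) (u - u₀) t := by
      simpa using ((hasDerivAt_id t).smul_const (u - u₀)).const_add u₀
    exact (hF.differentiable (by simp) _).hasFDerivAt.comp_hasDerivAt t hline
  have hFTC := intervalIntegral.integral_eq_sub_of_hasDerivAt (fun t _ => hderiv t)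
    ((hcont.clm_apply continuous_const).intervalIntegrable 0 1)
  rw [ContinuousLinearMap.intervalIntegral_apply (hcont.intervalIntegrable 0 1), hFTC]
  simp

end Hadamard

/-! ### Smooth functions and the ideals of functions vanishing at a point -/

section SmoothFun

variable {n : ℕ} {M : Type*} [TopologicalSpace M] [ChartedSpace (EuclideanSpace ℝ (Fin n)) M]

namespace SmoothFun

/-- The element of `C^∞(M)` given by a function and the proof that it is smooth. -/
def mk (f : M → ℂ) (hf : ContMDiff (𝓡 n) 𝓘(ℝ, ℂ) ∞ f) : SmoothFun n M := ⟨f, hf⟩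

theorem mk_apply (f : M → ℂ) (hf : ContMDiff (𝓡 n) 𝓘(ℝ, ℂ) ∞ f) (x : M) : mk f hf x = f x := rfl

theorem contMDiff (f : SmoothFun n M) : ContMDiff (𝓡 n) 𝓘(ℝ, ℂ) ∞ (f : M → ℂ) := f.2

theorem mdifferentiableAt (f : SmoothFun n M) (x : M) :
    MDifferentiableAt (𝓡 n) 𝓘(ℝ, ℂ) (f : M → ℂ) x :=
  f.contMDiff.mdifferentiableAt (by simp)

theorem ext {f g : SmoothFun n M} (h : ∀ x, f x = g x) : f = g :=
  Subtype.ext (funext h)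

theorem one_apply (x : M) : (1 : SmoothFun n M) x = 1 := rfl

theorem sub_apply (f g : SmoothFun n M) (x : M) : (f - g) x = f x - g x := rfl

theorem algebraMap_apply (c : ℂ) (x : M) : (algebraMap ℂ (SmoothFun n M) c) x = c := rfl

/-- Evaluation at a point as an algebra homomorphism `C^∞(M) → ℂ`. -/
def eval (x : M) : SmoothFun n M →ₐ[ℂ] ℂ :=
  (Pi.evalAlgHom ℂ (fun _ : M => ℂ) x).comp (smoothFunctions n M).val

theorem sum_apply {ι : Type*} (s : Finset ι) (f : ι → SmoothFun n M) (x : M) :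
    (∑ i ∈ s, f i) x = ∑ i ∈ s, f i x :=
  map_sum (eval x) f s

theorem prod_apply {ι : Type*} (s : Finset ι) (f : ι → SmoothFun n M) (x : M) :
    (∏ i ∈ s, f i) x = ∏ i ∈ s, f i x :=
  map_prod (eval x) f s

theorem pow_apply (f : SmoothFun n M) (k : ℕ) (x : M) : (f ^ k) x = f x ^ k :=
  map_pow (eval x) f k

/-- A real smooth function as an element of `C^∞(M)`. -/
def ofReal (f : M → ℝ) (hf : ContMDiff (𝓡 n) 𝓘(ℝ, ℝ) ∞ f) : SmoothFun n M :=
  mk (fun x => (f x : ℂ)) (Complex.ofRealCLM.contDiff.contMDiff.comp hf)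

theorem ofReal_apply (f : M → ℝ) (hf : ContMDiff (𝓡 n) 𝓘(ℝ, ℝ) ∞ f) (x : M) :
    ofReal f hf x = (f x : ℂ) := rfl

end SmoothFun

theorem mem_vanishingIdeal {x : M} {f : SmoothFun n M} : f ∈ vanishingIdeal n x ↔ f x = 0 :=
  Iff.rfl

theorem sub_algebraMap_mem_vanishingIdeal (x : M) (f : SmoothFun n M) :
    f - algebraMap ℂ (SmoothFun n M) (f x) ∈ vanishingIdeal n x := by
  rw [mem_vanishingIdeal, SmoothFun.sub_apply, SmoothFun.algebraMap_apply, sub_self]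

end SmoothFun

section Differential

variable {E H M V : Type*} [NormedAddCommGroup E] [NormedSpace ℝ E] [TopologicalSpace H]
  {I : ModelWithCorners ℝ E H} [TopologicalSpace M] [ChartedSpace H M]
  [NormedAddCommGroup V] [NormedSpace ℝ V] {x : M}

theorem mvfderiv_congr_of_eventuallyEq {f g : M → V} (h : f =ᶠ[nhds x] g)
    (v : TangentSpace I x) : mvfderiv I f x v = mvfderiv I g x v :=
  congrArg (fun L : TangentSpace I x → V => L v)
    (congrArg DFunLike.coe (h.mfderiv_eq (I := I) (I' := 𝓘(ℝ, V))))

theorem mvfderiv_ofReal_apply {f : M → ℝ} (hf : MDifferentiableAt I 𝓘(ℝ, ℝ) f x)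
    (v : TangentSpace I x) :
    mvfderiv I (fun y => (f y : ℂ)) x v = ((mvfderiv I f x v : ℝ) : ℂ) := by
  refine (mfderiv_comp_apply (g := Complex.ofRealCLM) x
    Complex.ofRealCLM.differentiableAt.mdifferentiableAt hf v).trans ?_
  rw [mfderiv_eq_fderiv, ContinuousLinearMap.fderiv]
  rfl

end Differential

/-! ### Coordinate functions and Hadamard's lemma on a manifold -/

section CoordSection

variable {n : ℕ} {M : Type*} [TopologicalSpace M] [ChartedSpace (EuclideanSpace ℝ (Fin n)) M]
  {V : Type*} [NormedAddCommGroup V] [NormedSpace ℝ V]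

theorem mvfderiv_comp_extChartAt [IsManifold (𝓡 n) ∞ M] (x : M) {g : EuclideanSpace ℝ (Fin n) → V}
    (hg : Differentiable ℝ g) {y : M}
    (hy : y ∈ (chartAt (EuclideanSpace ℝ (Fin n)) x).source) (v : TangentSpace (𝓡 n) y) :
    mvfderiv (𝓡 n) (fun y => g (extChartAt (𝓡 n) x y)) y v =
      fderiv ℝ g (extChartAt (𝓡 n) x y)
        (mfderiv (𝓡 n) 𝓘(ℝ, EuclideanSpace ℝ (Fin n)) (extChartAt (𝓡 n) x) y v) := by
  refine (mfderiv_comp_apply (g := g) y (hg _).mdifferentiableAt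
    (mdifferentiableAt_extChartAt hy) v).trans ?_
  rw [mfderiv_eq_fderiv]
  rfl

variable (n) in
/-- A smooth bump function at `x`, supported in the domain of the preferred chart at `x`. -/
def bump (x : M) : SmoothBumpFunction (𝓡 n) x := Classical.arbitrary _

/-- The pullback of `g` along the chart at `x`, multiplied by the bump function at `x`, which makes
it a function on all of `M`. -/
def bumpPullback (x : M) (g : EuclideanSpace ℝ (Fin n) → V) (y : M) : V :=
  bump n x y • g (extChartAt (𝓡 n) x y)

theorem contMDiff_bumpPullback [IsManifold (𝓡 n) ∞ M] [T2Space M] (x : M)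
    {g : EuclideanSpace ℝ (Fin n) → V} (hg : ContDiff ℝ ∞ g) :
    ContMDiff (𝓡 n) 𝓘(ℝ, V) ∞ (bumpPullback x g) :=
  (bump n x).contMDiff_smul (hg.contMDiff.comp_contMDiffOn contMDiffOn_extChartAt)

theorem bumpPullback_self (x : M) (g : EuclideanSpace ℝ (Fin n) → V) :
    bumpPullback x g x = g (extChartAt (𝓡 n) x x) := by
  rw [bumpPullback, (bump n x).eq_one, one_smul]

theorem bumpPullback_eventuallyEq (x : M) (g : EuclideanSpace ℝ (Fin n) → V) :
    bumpPullback x g =ᶠ[nhds x] fun y => g (extChartAt (𝓡 n) x y) := by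
  filter_upwards [(bump n x).eventuallyEq_one] with y hy
  rw [bumpPullback, hy, Pi.one_apply, one_smul]

theorem mvfderiv_bumpPullback_self [IsManifold (𝓡 n) ∞ M] (x : M)
    {g : EuclideanSpace ℝ (Fin n) → V} (hg : Differentiable ℝ g) (v : TangentSpace (𝓡 n) x) :
    mvfderiv (𝓡 n) (bumpPullback x g) x v = fderiv ℝ g (extChartAt (𝓡 n) x x) v := by
  rw [mvfderiv_congr_of_eventuallyEq (bumpPullback_eventuallyEq x g),
    mvfderiv_comp_extChartAt x hg (mem_chart_source _ x), mfderiv_extChartAt_self]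
  rfl

theorem contDiff_bump_smul_comp_symm [IsManifold (𝓡 n) ∞ M] (x : M) {f : M → V}
    (hf : ContMDiff (𝓡 n) 𝓘(ℝ, V) ∞ f) : ContDiff ℝ ∞
      (fun u => (bump n x).toContDiffBump u • f ((extChartAt (𝓡 n) x).symm u)) := by
  rw [contDiff_iff_contDiffAt]
  intro u
  by_cases hu : u ∈ (extChartAt (𝓡 n) x).target
  · refine (bump n x).toContDiffBump.contDiffAt.smul (contMDiffAt_iff_contDiffAt.1 ?_)
    exact (hf _).comp u
      ((contMDiffOn_extChartAt_symm x).contMDiffAt ((isOpen_extChartAt_target x).mem_nhds hu))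
  · have hball : u ∉ Metric.closedBall (extChartAt (𝓡 n) x x) (bump n x).rOut := fun h =>
      hu ((bump n x).closedBall_subset ⟨h, by simp⟩)
    refine (contDiffAt_const (c := 0)).congr_of_eventuallyEq ?_
    filter_upwards [Metric.isClosed_closedBall.isOpen_compl.mem_nhds hball] with w hw
    rw [(bump n x).toContDiffBump.zero_of_le_dist (not_le.1 fun h => hw h).le, zero_smul]

theorem fderiv_bump_smul_comp_symm (x : M) (f : SmoothFun n M) (i : Fin n) :
    fderiv ℝ (fun u => (bump n x).toContDiffBump u • f ((extChartAt (𝓡 n) x).symm u))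
        (extChartAt (𝓡 n) x x) (EuclideanSpace.basisFun (Fin n) ℝ i) =
      mvfderiv (𝓡 n) (f : M → ℂ) x (tangentBasis x i) := by
  have hlocal : (fun u => (bump n x).toContDiffBump u • f ((extChartAt (𝓡 n) x).symm u))
      =ᶠ[nhds (extChartAt (𝓡 n) x x)] writtenInExtChartAt (𝓡 n) 𝓘(ℝ, ℂ) x (f : M → ℂ) := by
    filter_upwards [(bump n x).toContDiffBump.eventuallyEq_one] with u hu
    rw [hu]
    exact one_smul ℝ (f ((extChartAt (𝓡 n) x).symm u))
  rw [(f.mdifferentiableAt x).mvfderiv, ModelWithCorners.range_eq_univ, fderivWithin_univ,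
    hlocal.fderiv_eq]
  exact congrArg _ (congrFun (EuclideanSpace.basisFun (Fin n) ℝ).coe_toBasis i).symm

variable [IsManifold (𝓡 n) ∞ M] [T2Space M]

variable (n) in
/-- A linear section of `f ↦ df_x` on the functions that vanish at `x`: the covector `ξ` is sent to
the coordinate function `y ↦ ξ(y - x)` of the chart at `x`, cut off by the bump function. -/
def coordSection (x : M) : Cotangent n M x →ₗ[ℝ] SmoothFun n M where
  toFun ξ := SmoothFun.ofReal
    (bumpPullback x fun u => (ξ : EuclideanSpace ℝ (Fin n) →L[ℝ] ℝ) (u - extChartAt (𝓡 n) x x))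
    (contMDiff_bumpPullback x ((ContinuousLinearMap.contDiff _).comp
      (contDiff_id.sub contDiff_const)))
  map_add' ξ η := SmoothFun.ext fun y => by
    simp only [SmoothFun.add_apply, SmoothFun.ofReal_apply, ← Complex.ofReal_add, bumpPullback,
      ← smul_add]
    rfl
  map_smul' c ξ := SmoothFun.ext fun y => by
    change _ = (c : ℂ) * _
    simp only [SmoothFun.ofReal_apply, ← Complex.ofReal_mul, bumpPullback]
    rw [← smul_eq_mul c, smul_comm]
    rfl

theorem coordSection_apply (x : M) (ξ : Cotangent n M x) (y : M) :
    coordSection n x ξ y = ((bumpPullback x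
      (fun u => (ξ : EuclideanSpace ℝ (Fin n) →L[ℝ] ℝ) (u - extChartAt (𝓡 n) x x)) y : ℝ) : ℂ) :=
  rfl

theorem coordSection_mem_vanishingIdeal (x : M) (ξ : Cotangent n M x) :
    coordSection n x ξ ∈ vanishingIdeal n x := by
  rw [mem_vanishingIdeal, coordSection_apply, Complex.ofReal_eq_zero, bumpPullback_self]
  exact (congrArg ξ (sub_self (extChartAt (𝓡 n) x x))).trans (map_zero ξ)

theorem mvfderiv_coordSection (x : M) (ξ : Cotangent n M x) (v : TangentSpace (𝓡 n) x) :
    mvfderiv (𝓡 n) (coordSection n x ξ : M → ℂ) x v = ((ξ v : ℝ) : ℂ) := by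
  let ξ' : EuclideanSpace ℝ (Fin n) →L[ℝ] ℝ := ξ
  have hsmooth : ContDiff ℝ ∞ fun u => ξ' (u - extChartAt (𝓡 n) x x) :=
    ξ'.contDiff.comp (contDiff_id.sub contDiff_const)
  have hderiv : HasFDerivAt (fun u => ξ' (u - extChartAt (𝓡 n) x x)) ξ' (extChartAt (𝓡 n) x x) :=
    ξ'.hasFDerivAt.comp _ ((hasFDerivAt_id _).sub_const _)
  refine (mvfderiv_ofReal_apply
    ((contMDiff_bumpPullback x hsmooth).mdifferentiableAt (by simp)) v).trans ?_
  rw [mvfderiv_bumpPullback_self x (hsmooth.differentiable (by simp)), hderiv.fderiv]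
  rfl

-- Three factors of the bump function cut off, respectively, `f`, the coordinate functions and the
-- functions `H i` that Hadamard's lemma yields in the chart.
theorem exists_bump_pow_mul_eq_sum_coordSection_mul (x : M) {f : SmoothFun n M}
    (hf : f ∈ vanishingIdeal n x) :
    ∃ H : Fin n → SmoothFun n M,
      (∀ i, H i x = mvfderiv (𝓡 n) (f : M → ℂ) x (tangentBasis x i)) ∧
      SmoothFun.ofReal (bump n x) (bump n x).contMDiff ^ 3 * f =
        ∑ i, coordSection n x (dualBasis x i) * H i := by
  obtain ⟨G, hG, hG₀, hFG⟩ := hadamard (contDiff_bump_smul_comp_symm x f.contMDiff)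
    (extChartAt (𝓡 n) x x)
  let h (i : Fin n) (u : EuclideanSpace ℝ (Fin n)) : ℂ := G u (EuclideanSpace.basisFun (Fin n) ℝ i)
  have hh (i : Fin n) : ContDiff ℝ ∞ (h i) := hG.clm_apply contDiff_const
  refine ⟨fun i => SmoothFun.mk (bumpPullback x (h i)) (contMDiff_bumpPullback x (hh i)),
    fun i => ?_, SmoothFun.ext fun y => ?_⟩
  · rw [SmoothFun.mk_apply, bumpPullback_self, ← fderiv_bump_smul_comp_symm, ← hG₀]
  simp only [SmoothFun.mul_apply, SmoothFun.pow_apply, SmoothFun.ofReal_apply, SmoothFun.sum_apply,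
    SmoothFun.mk_apply, coordSection_apply, bumpPullback]
  by_cases hy : y ∈ (chartAt (EuclideanSpace ℝ (Fin n)) x).source
  · have hχ : (bump n x).toContDiffBump (extChartAt (𝓡 n) x y) = bump n x y :=
      ((bump n x).eqOn_source hy).symm
    have hexpand : (bump n x y : ℂ) * f y =
        ∑ i, ((extChartAt (𝓡 n) x y - extChartAt (𝓡 n) x x) i : ℂ) *
          h i (extChartAt (𝓡 n) x y) := by
      have hFy := hFG (extChartAt (𝓡 n) x y)
      rw [hχ, (extChartAt (𝓡 n) x).left_inv (by rwa [extChartAt_source]), extChartAt_to_inv,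
        mem_vanishingIdeal.1 hf, smul_zero, zero_add, Complex.real_smul,
        ← (EuclideanSpace.basisFun (Fin n) ℝ).sum_repr
          (extChartAt (𝓡 n) x y - extChartAt (𝓡 n) x x), map_sum] at hFy
      simpa only [map_smul, Complex.real_smul, EuclideanSpace.basisFun_repr] using hFy
    rw [pow_succ, mul_assoc, hexpand, Finset.mul_sum]
    refine Finset.sum_congr rfl fun i _ => ?_
    rw [smul_eq_mul, Complex.ofReal_mul, Complex.real_smul]
    change _ = _ * ((extChartAt (𝓡 n) x y - extChartAt (𝓡 n) x x) i : ℂ) * _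
    ring
  · have hχ : bump n x y = 0 := by
      by_contra h
      exact hy ((bump n x).support_subset_source h)
    simp [hχ]

theorem sub_sum_coordSection_mem (x : M) {f : SmoothFun n M} (hf : f ∈ vanishingIdeal n x) :
    f - ∑ i, mvfderiv (𝓡 n) (f : M → ℂ) x (tangentBasis x i) • coordSection n x (dualBasis x i) ∈
      vanishingIdeal n x ^ 2 := by
  obtain ⟨H, hH, hsum⟩ := exists_bump_pow_mul_eq_sum_coordSection_mul x hf
  set χ : SmoothFun n M := SmoothFun.ofReal (bump n x) (bump n x).contMDiff
  have hχ : 1 - χ ^ 3 ∈ vanishingIdeal n x := by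
    rw [mem_vanishingIdeal, SmoothFun.sub_apply, SmoothFun.one_apply, SmoothFun.pow_apply,
      SmoothFun.ofReal_apply, (bump n x).eq_one, Complex.ofReal_one, one_pow, sub_self]
  have hsplit : f - ∑ i, mvfderiv (𝓡 n) (f : M → ℂ) x (tangentBasis x i) •
      coordSection n x (dualBasis x i) =
        (1 - χ ^ 3) * f + ∑ i, coordSection n x (dualBasis x i) *
          (H i - algebraMap ℂ (SmoothFun n M) (H i x)) := by
    simp only [sub_mul, one_mul, hsum, mul_sub, Finset.sum_sub_distrib, ← hH, Algebra.smul_def,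
      mul_comm (coordSection n x _) (algebraMap ℂ _ _)]
    abel
  rw [hsplit, pow_two]
  exact Ideal.add_mem _ (Ideal.mul_mem_mul hχ hf) (Ideal.sum_mem _ fun i _ => Ideal.mul_mem_mul
    (coordSection_mem_vanishingIdeal x _) (sub_algebraMap_mem_vanishingIdeal x _))

end CoordSection

/-! ### Functions and vector fields that are smooth near a point -/

section SmoothNear

open Filter Topology

variable {E H M V A : Type*} [NormedAddCommGroup E] [NormedSpace ℝ E] [TopologicalSpace H]
  {I : ModelWithCorners ℝ E H} [TopologicalSpace M] [ChartedSpace H M]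
  [NormedAddCommGroup V] [NormedSpace ℝ V] [NormedCommRing A] [NormedAlgebra ℝ A]
  {x : M}

variable (I) in
/-- The function `f` is smooth on a neighbourhood of `x`. This is stronger than `ContMDiffAt` with
exponent `∞`, which allows the neighbourhood to shrink with the order of differentiability. -/
def SmoothNear (f : M → V) (x : M) : Prop :=
  ∀ᶠ y in 𝓝 x, ContMDiffAt I 𝓘(ℝ, V) ∞ f y

namespace SmoothNear

variable {f g : M → V}

theorem of_contMDiff (h : ContMDiff I 𝓘(ℝ, V) ∞ f) : SmoothNear I f x :=
  .of_forall h

theorem eventually (h : SmoothNear I f x) : ∀ᶠ y in 𝓝 x, SmoothNear I f y :=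
  eventually_eventually_nhds.2 h

theorem mdifferentiableAt (h : SmoothNear I f x) : MDifferentiableAt I 𝓘(ℝ, V) f x :=
  h.self_of_nhds.mdifferentiableAt (by simp)

theorem congr (h : SmoothNear I f x) (e : g =ᶠ[𝓝 x] f) : SmoothNear I g x := by
  filter_upwards [h, e.eventuallyEq_nhds] with y hy hy' using hy.congr_of_eventuallyEq hy'

theorem const (c : V) : SmoothNear I (fun _ : M => c) x :=
  of_contMDiff contMDiff_const

theorem add (hf : SmoothNear I f x) (hg : SmoothNear I g x) :
    SmoothNear I (fun y => f y + g y) x := by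
  filter_upwards [hf, hg] with y hfy hgy using hfy.add hgy

theorem sub (hf : SmoothNear I f x) (hg : SmoothNear I g x) :
    SmoothNear I (fun y => f y - g y) x := by
  filter_upwards [hf, hg] with y hfy hgy using hfy.sub hgy

theorem sum {ι : Type*} {s : Finset ι} {F : ι → M → V} (hF : ∀ i ∈ s, SmoothNear I (F i) x) :
    SmoothNear I (fun y => ∑ i ∈ s, F i y) x := by
  filter_upwards [(eventually_all_finset s).2 hF] with y hy using ContMDiffAt.sum hy

theorem mul {f g : M → A} (hf : SmoothNear I f x) (hg : SmoothNear I g x) :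
    SmoothNear I (fun y => f y * g y) x := by
  filter_upwards [hf, hg] with y hfy hgy using
    (contDiff_mul (𝕜 := ℝ) (𝔸 := A)).contMDiff.contMDiffAt.comp y (hfy.prodMk_space hgy)

theorem prod {ι : Type*} {s : Finset ι} {F : ι → M → A} (hF : ∀ i ∈ s, SmoothNear I (F i) x) :
    SmoothNear I (fun y => ∏ i ∈ s, F i y) x := by
  classical
  induction s using Finset.induction_on with
  | empty => simpa using const (1 : A)
  | insert a s ha ih =>
    simp only [Finset.prod_insert ha]
    exact (hF a (Finset.mem_insert_self _ _)).mul
      (ih fun i hi => hF i (Finset.mem_insert_of_mem hi))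

theorem pow {f : M → A} (hf : SmoothNear I f x) (k : ℕ) : SmoothNear I (fun y => f y ^ k) x := by
  simpa using prod (s := Finset.range k) fun _ _ => hf

end SmoothNear

variable [IsManifold I ∞ M] {X Y : ∀ x : M, TangentSpace I x}

variable (I) in
/-- The vector field `X` is smooth on a neighbourhood of `x`. -/
def SmoothFieldNear (X : ∀ x : M, TangentSpace I x) (x : M) : Prop :=
  ∀ᶠ y in 𝓝 x, ContMDiffAt I (I.prod 𝓘(ℝ, E)) ∞ (fun z => (⟨z, X z⟩ : TangentBundle I M)) y

namespace SmoothFieldNear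

theorem eventually (h : SmoothFieldNear I X x) : ∀ᶠ y in 𝓝 x, SmoothFieldNear I X y :=
  eventually_eventually_nhds.2 h

theorem mdifferentiableAt (h : SmoothFieldNear I X x) :
    MDifferentiableAt I (I.prod 𝓘(ℝ, E)) (fun z => (⟨z, X z⟩ : TangentBundle I M)) x :=
  h.self_of_nhds.mdifferentiableAt (by simp)

theorem congr (h : SmoothFieldNear I X x) (e : ∀ᶠ y in 𝓝 x, Y y = X y) :
    SmoothFieldNear I Y x := by
  filter_upwards [h, eventually_eventually_nhds.2 e] with y hy hy'
  exact hy.congr_of_eventuallyEq (hy'.mono fun z hz => congrArg (Bundle.TotalSpace.mk z) hz)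

theorem add (hX : SmoothFieldNear I X x) (hY : SmoothFieldNear I Y x) :
    SmoothFieldNear I (X + Y) x := by
  filter_upwards [hX, hY] with y hXy hYy using hXy.add_section hYy

theorem smul {a : M → ℝ} (ha : SmoothNear I a x) (hX : SmoothFieldNear I X x) :
    SmoothFieldNear I (a • X) x := by
  filter_upwards [ha, hX] with y hay hXy using hay.smul_section hXy

theorem sum {ι : Type*} {s : Finset ι} {X : ι → ∀ x : M, TangentSpace I x}
    (hX : ∀ i ∈ s, SmoothFieldNear I (X i) x) : SmoothFieldNear I (∑ i ∈ s, X i) x := by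
  filter_upwards [(eventually_all_finset s).2 hX] with y hy
  simpa using ContMDiffAt.sum_section hy

theorem zero : SmoothFieldNear I (0 : ∀ x : M, TangentSpace I x) x :=
  .of_forall (Bundle.contMDiff_zeroSection ℝ (TangentSpace I : M → Type _))

theorem extend [FiniteDimensional ℝ E] (v : TangentSpace I x) :
    SmoothFieldNear I (FiberBundle.extend E v) x := by
  obtain ⟨s, hs, h⟩ := FiberBundle.exists_contMDiffOn_extend (k := ∞) I E v
  filter_upwards [eventually_mem_nhds_iff.2 hs] with y hy using h.contMDiffAt hy

theorem update {r : ℕ} {X : Fin r → ∀ x : M, TangentSpace I x}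
    (hX : ∀ i, SmoothFieldNear I (X i) x) (j : Fin r) (hY : SmoothFieldNear I Y x) (i : Fin r) :
    SmoothFieldNear I (Function.update X j Y i) x := by
  by_cases h : i = j
  · subst h; simpa using hY
  · simpa [Function.update_of_ne h] using hX i

theorem exists_contMDiff_eventuallyEq [FiniteDimensional ℝ E] [T2Space M]
    (hX : SmoothFieldNear I X x) :
    ∃ Y : ∀ x : M, TangentSpace I x,
      ContMDiff I (I.prod 𝓘(ℝ, E)) ∞ (fun z => (⟨z, Y z⟩ : TangentBundle I M)) ∧
        ∀ᶠ y in 𝓝 x, Y y = X y := by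
  obtain ⟨χ, -, hχ⟩ := (SmoothBumpFunction.nhds_basis_tsupport (I := I) x).mem_iff.1 hX
  refine ⟨(χ : M → ℝ) • X, fun y => ?_, ?_⟩
  · by_cases hy : y ∈ tsupport χ
    · exact (χ.contMDiff y).smul_section (hχ hy)
    · refine (Bundle.contMDiff_zeroSection ℝ (TangentSpace I : M → Type _) y).congr_of_eventuallyEq
        ?_
      filter_upwards [(isClosed_tsupport χ).isOpen_compl.mem_nhds hy] with z hz
      simp [image_eq_zero_of_notMem_tsupport hz, Bundle.zeroSection]
  · filter_upwards [χ.eventuallyEq_one] with y hy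
    simp [hy]

end SmoothFieldNear

theorem SmoothNear.mvfderiv {f : M → V} (hf : SmoothNear I f x) (hX : SmoothFieldNear I X x) :
    SmoothNear I (fun y => mvfderiv I f y (X y)) x := by
  filter_upwards [hf, hX] with y hfy hXy
  have hdiff := ContMDiffAt.clm_apply_of_inCoordinates (b₁ := fun z => z) (b₂ := f)
    (v := X) (ϕ := fun z => mfderiv I 𝓘(ℝ, V) f z) (E₂ := fun z : V => TangentSpace 𝓘(ℝ, V) z)
    (hfy.mfderiv_const (m := ∞) (by simp)) hXy hfy
  exact (contMDiff_snd_tangentBundle_modelSpace V 𝓘(ℝ, V)).contMDiffAt.comp y hdiff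

end SmoothNear

section Connection

open Filter Topology

variable {n : ℕ} {M : Type*} [TopologicalSpace M] [ChartedSpace (EuclideanSpace ℝ (Fin n)) M]
  [IsManifold (𝓡 n) ∞ M] (cov : LinearConnection n M) {x : M}
  {X Y Z : ∀ x : M, TangentSpace (𝓡 n) x}

theorem cov_congr (hY : SmoothFieldNear (𝓡 n) Y x) (h : ∀ᶠ y in 𝓝 x, Z y = Y y) :
    cov Z x = cov Y x :=
  cov.isCovariantDerivativeOnUniv.congr_of_eventuallyEq (hY.congr h).mdifferentiableAt
    hY.mdifferentiableAt univ_mem h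

theorem SmoothFieldNear.covariant [T2Space M] [cov.ContMDiffCovariantDerivative ∞]
    (hX : SmoothFieldNear (𝓡 n) X x) (hY : SmoothFieldNear (𝓡 n) Y x) :
    SmoothFieldNear (𝓡 n) (fun y => cov Y y (X y)) x := by
  obtain ⟨Z, hZ, hZY⟩ := hY.exists_contMDiff_eventuallyEq
  have hcovZ := (CovariantDerivative.ContMDiffCovariantDerivative.contMDiff (cov := cov)
    (k := ∞)).contMDiff (σ := Z) (by simpa using hZ.contMDiffOn)
  have hZX : SmoothFieldNear (𝓡 n) (fun y => cov Z y (X y)) x := by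
    filter_upwards [hX] with y hy
    exact ((hcovZ y trivial).contMDiffAt univ_mem).clm_bundle_apply hy
  refine hZX.congr ?_
  filter_upwards [hY.eventually, eventually_eventually_nhds.2 hZY] with y hYy hZYy
  rw [cov_congr cov hYy hZYy]

theorem eventually_cov_smul_add {a : M → ℝ} (ha : SmoothNear (𝓡 n) a x)
    (hY : SmoothFieldNear (𝓡 n) Y x) (hZ : SmoothFieldNear (𝓡 n) Z x) :
    ∀ᶠ y in 𝓝 x, cov (a • Y + Z) y (X y) =
      ((fun y => mvfderiv (𝓡 n) a y (X y)) • Y +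
        (a • (fun y => cov Y y (X y)) + (fun y => cov Z y (X y))) :
          ∀ x : M, TangentSpace (𝓡 n) x) y := by
  filter_upwards [ha.eventually, hY.eventually, hZ.eventually] with y hay hYy hZy
  rw [cov.isCovariantDerivativeOnUniv.add (hYy.smul hay).mdifferentiableAt hZy.mdifferentiableAt,
    cov.isCovariantDerivativeOnUniv.leibniz hYy.mdifferentiableAt hay.mdifferentiableAt,
    ← add_assoc, add_comm (_ • Y)]
  rfl

end Connection

/-! ### Tensoriality of the iterated covariant differential -/

section Tensoriality

open Filter Topology

variable {n : ℕ} {M V : Type*} [TopologicalSpace M] [ChartedSpace (EuclideanSpace ℝ (Fin n)) M]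
  [IsManifold (𝓡 n) ∞ M] [NormedAddCommGroup V] [NormedSpace ℝ V]

variable (n) in
/-- The `i`-th coordinate vector field of the preferred chart at `x₀`, extended by junk values
outside the domain of the chart. -/
def coordFrame (x₀ : M) (i : Fin n) : ∀ x : M, TangentSpace (𝓡 n) x :=
  (trivializationAt (EuclideanSpace ℝ (Fin n)) (TangentSpace (𝓡 n) : M → Type) x₀).localFrame
    (EuclideanSpace.basisFun (Fin n) ℝ).toBasis i

variable (n) in
/-- The coefficient of a tangent vector at `x` along the coordinate field `coordFrame n x₀ i`. -/
def coordCoeff (x₀ : M) (i : Fin n) (x : M) : TangentSpace (𝓡 n) x →ₗ[ℝ] ℝ :=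
  (trivializationAt (EuclideanSpace ℝ (Fin n)) (TangentSpace (𝓡 n) : M → Type) x₀).localFrameCoeff
    (𝓡 n) (EuclideanSpace.basisFun (Fin n) ℝ).toBasis i x

theorem eventually_mem_baseSet (x₀ : M) : ∀ᶠ x in 𝓝 x₀, x ∈ (trivializationAt
    (EuclideanSpace ℝ (Fin n)) (TangentSpace (𝓡 n) : M → Type) x₀).baseSet :=
  (trivializationAt (EuclideanSpace ℝ (Fin n)) (TangentSpace (𝓡 n) : M → Type)
    x₀).open_baseSet.mem_nhds (FiberBundle.mem_baseSet_trivializationAt' x₀)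

theorem smoothFieldNear_coordFrame (x₀ : M) (i : Fin n) :
    SmoothFieldNear (𝓡 n) (coordFrame n x₀ i) x₀ := by
  filter_upwards [eventually_mem_baseSet (n := n) x₀] with x hx
  exact contMDiffAt_localFrame_of_mem ∞ _ _ i hx

theorem smoothNear_coordCoeff {x₀ : M} {X : ∀ x : M, TangentSpace (𝓡 n) x}
    (hX : SmoothFieldNear (𝓡 n) X x₀) (i : Fin n) :
    SmoothNear (𝓡 n) (fun x => coordCoeff n x₀ i x (X x)) x₀ := by
  filter_upwards [eventually_mem_baseSet (n := n) x₀, hX] with x hx h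
  exact contMDiffAt_localFrameCoeff (EuclideanSpace.basisFun (Fin n) ℝ).toBasis hx h i

theorem eventually_eq_sum_coordFrame (x₀ : M) :
    ∀ᶠ x in 𝓝 x₀, ∀ v : TangentSpace (𝓡 n) x,
      v = ∑ i, coordCoeff n x₀ i x v • coordFrame n x₀ i x := by
  classical
  filter_upwards [eventually_mem_baseSet (n := n) x₀] with x hx v
  have := Bundle.Trivialization.eq_sum_localFrameCoeff_smul (I := 𝓡 n)
    (b := (EuclideanSpace.basisFun (Fin n) ℝ).toBasis)
    (s := fun y => if h : y = x then h ▸ v else 0) hx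
  simpa using! this

/-- Maps from `r`-tuples of vector fields to functions that are given by a smooth covariant tensor
field of order `r`: they preserve smoothness and are linear over the functions in each slot. All
fields and coefficients need only be smooth near the point considered; linearity is stated for
combinations `a • Y + Z`, so that additivity and homogeneity are handled together. -/
structure IsTensorial {r : ℕ} (T : (Fin r → ∀ x : M, TangentSpace (𝓡 n) x) → M → V) : Prop where
  smooth : ∀ {x X}, (∀ i, SmoothFieldNear (𝓡 n) (X i) x) → SmoothNear (𝓡 n) (T X) x
  smul_add : ∀ {x X}, (∀ i, SmoothFieldNear (𝓡 n) (X i) x) → ∀ (j) {a : M → ℝ} {Y Z},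
    SmoothNear (𝓡 n) a x → SmoothFieldNear (𝓡 n) Y x → SmoothFieldNear (𝓡 n) Z x →
      T (Function.update X j (a • Y + Z)) x =
        a x • T (Function.update X j Y) x + T (Function.update X j Z) x

namespace IsTensorial

variable {r : ℕ} {T : (Fin r → ∀ x : M, TangentSpace (𝓡 n) x) → M → V} (hT : IsTensorial T)
  {x : M} {X X' : Fin r → ∀ x : M, TangentSpace (𝓡 n) x}
  (hX : ∀ i, SmoothFieldNear (𝓡 n) (X i) x) (j : Fin r) {Y Z : ∀ x : M, TangentSpace (𝓡 n) x}

include hT hX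

theorem update_zero : T (Function.update X j 0) x = 0 := by
  have h := hT.smul_add hX j (SmoothNear.const (1 : ℝ)) SmoothFieldNear.zero SmoothFieldNear.zero
  rw [smul_zero, add_zero, one_smul] at h
  exact left_eq_add.1 h

theorem update_smul {a : M → ℝ} (ha : SmoothNear (𝓡 n) a x) (hY : SmoothFieldNear (𝓡 n) Y x) :
    T (Function.update X j (a • Y)) x = a x • T (Function.update X j Y) x := by
  have h := hT.smul_add hX j ha hY SmoothFieldNear.zero
  rwa [add_zero, hT.update_zero hX, add_zero] at h

theorem update_congr (hY : SmoothFieldNear (𝓡 n) Y x) (h : ∀ᶠ y in 𝓝 x, Z y = Y y) :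
    T (Function.update X j Z) x = T (Function.update X j Y) x := by
  classical
  let ψ : M → ℝ := fun y => if Z y = Y y then 1 else 0
  have hψZY : ψ • Z = ψ • Y := by
    funext y
    by_cases hy : Z y = Y y <;> simp [ψ, hy]
  have hψ : SmoothNear (𝓡 n) ψ x := by
    refine (SmoothNear.const (1 : ℝ)).congr ?_
    filter_upwards [h] with y hy
    simp [ψ, hy]
  have hψx : ψ x = 1 := by simp [ψ, h.self_of_nhds]
  calc T (Function.update X j Z) x = T (Function.update X j (ψ • Z)) x := by
        rw [hT.update_smul hX j hψ (hY.congr h), hψx, one_smul]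
    _ = T (Function.update X j Y) x := by
        rw [hψZY, hT.update_smul hX j hψ hY, hψx, one_smul]

theorem update_sum {ι : Type*} (s : Finset ι) {a : ι → M → ℝ}
    {W : ι → ∀ x : M, TangentSpace (𝓡 n) x} (ha : ∀ i ∈ s, SmoothNear (𝓡 n) (a i) x)
    (hW : ∀ i ∈ s, SmoothFieldNear (𝓡 n) (W i) x) :
    T (Function.update X j (∑ i ∈ s, a i • W i)) x =
      ∑ i ∈ s, a i x • T (Function.update X j (W i)) x := by
  classical
  induction s using Finset.induction_on with
  | empty => simpa using hT.update_zero hX j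
  | insert b s hb ih =>
    have has : ∀ i ∈ s, SmoothNear (𝓡 n) (a i) x := fun i hi => ha i (Finset.mem_insert_of_mem hi)
    have hWs : ∀ i ∈ s, SmoothFieldNear (𝓡 n) (W i) x :=
      fun i hi => hW i (Finset.mem_insert_of_mem hi)
    rw [Finset.sum_insert hb, Finset.sum_insert hb,
      hT.smul_add hX j (ha b (Finset.mem_insert_self _ _)) (hW b (Finset.mem_insert_self _ _))
        (.sum fun i hi => (hWs i hi).smul (has i hi)), ih has hWs]

theorem update_eq_sum_coordFrame (hY : SmoothFieldNear (𝓡 n) Y x) :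
    T (Function.update X j Y) x =
      ∑ i, coordCoeff n x i x (Y x) • T (Function.update X j (coordFrame n x i)) x := by
  have ha : ∀ i ∈ Finset.univ, SmoothNear (𝓡 n) (fun y => coordCoeff n x i y (Y y)) x :=
    fun i _ => smoothNear_coordCoeff hY i
  have hW : ∀ i ∈ Finset.univ, SmoothFieldNear (𝓡 n) (coordFrame n x i) x :=
    fun i _ => smoothFieldNear_coordFrame x i
  rw [← hT.update_sum hX j _ ha hW]
  refine hT.update_congr hX j (.sum fun i hi => (hW i hi).smul (ha i hi)) ?_
  filter_upwards [eventually_eq_sum_coordFrame (n := n) x] with y hy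
  simpa using hy (Y y)

theorem apply_eq_of_forall_eq (hX' : ∀ i, SmoothFieldNear (𝓡 n) (X' i) x)
    (h : ∀ i, X i x = X' i x) : T X x = T X' x := by
  classical
  have hpiecewise : ∀ s : Finset (Fin r), T (s.piecewise X' X) x = T X x := by
    intro s
    induction s using Finset.induction_on with
    | empty => simp
    | insert a s ha ih =>
      have hs : ∀ i, SmoothFieldNear (𝓡 n) (s.piecewise X' X i) x := by
        intro i
        by_cases hi : i ∈ s <;> simp [hi, hX, hX']
      rw [Finset.piecewise_insert, ← ih, hT.update_eq_sum_coordFrame hs a (hX' a), ← h a,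
        ← hT.update_eq_sum_coordFrame hs a (hX a)]
      congr 1
      rw [Function.update_eq_self_iff]
      simp [ha]
  rw [← hpiecewise Finset.univ, Finset.piecewise_univ]

end IsTensorial

theorem IsTensorial.apply_extend_update {r : ℕ}
    {T : (Fin r → ∀ x : M, TangentSpace (𝓡 n) x) → M → V} (hT : IsTensorial T) {x : M}
    (v : Fin r → TangentSpace (𝓡 n) x) (j : Fin r) {w : TangentSpace (𝓡 n) x}
    {Y : ∀ x : M, TangentSpace (𝓡 n) x} (hY : SmoothFieldNear (𝓡 n) Y x) (hw : Y x = w) :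
    T (fun i => FiberBundle.extend (EuclideanSpace ℝ (Fin n)) (Function.update v j w i)) x =
      T (Function.update (fun i => FiberBundle.extend (EuclideanSpace ℝ (Fin n)) (v i)) j Y) x := by
  refine hT.apply_eq_of_forall_eq (fun i => .extend _) (.update (fun i => .extend (v i)) j hY)
    fun i => ?_
  by_cases hi : i = j
  · subst hi; simp [hw]
  · simp [hi]

/-- The multilinear map on `T_xM` given by the tensor field `T`. Tangent vectors are extended to
vector fields; the value does not depend on the extension. -/
def IsTensorial.multilinearAt {r : ℕ} {T : (Fin r → ∀ x : M, TangentSpace (𝓡 n) x) → M → V}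
    (hT : IsTensorial T) (x : M) : MultilinearMap ℝ (fun _ : Fin r => TangentSpace (𝓡 n) x) V :=
  .mk' (fun v => T (fun i => FiberBundle.extend (EuclideanSpace ℝ (Fin n)) (v i)) x)
    (fun v j a b => by
      have hone : SmoothNear (𝓡 n) (fun _ : M => (1 : ℝ)) x := .const 1
      rw [hT.apply_extend_update v j (w := a) (.extend a) (by simp),
        hT.apply_extend_update v j (w := b) (.extend b) (by simp),
        hT.apply_extend_update v j (w := a + b) (.add (.smul hone (.extend a)) (.extend b))
          (by simp),
        hT.smul_add (fun i => .extend (v i)) j hone (.extend a) (.extend b), one_smul])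
    (fun v j c a => by
      have hc : SmoothNear (𝓡 n) (fun _ : M => c) x := .const c
      rw [hT.apply_extend_update v j (w := a) (.extend a) (by simp),
        hT.apply_extend_update v j (w := c • a) (.smul hc (.extend a)) (by simp),
        hT.update_smul (fun i => .extend (v i)) j hc (.extend a)])

theorem IsTensorial.multilinearAt_apply {r : ℕ}
    {T : (Fin r → ∀ x : M, TangentSpace (𝓡 n) x) → M → V} (hT : IsTensorial T) {x : M}
    {X : Fin r → ∀ x : M, TangentSpace (𝓡 n) x} (hX : ∀ i, SmoothFieldNear (𝓡 n) (X i) x) :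
    hT.multilinearAt x (fun i => X i x) = T X x :=
  hT.apply_eq_of_forall_eq (fun i => .extend (X i x)) hX fun i => by simp

section CovStep

variable (cov : LinearConnection n M)

/-- The step `T ↦ ∇T` in the recursive definition of the iterated covariant differential. -/
def covStep {r : ℕ} (T : (Fin r → ∀ x : M, TangentSpace (𝓡 n) x) → M → V)
    (X : Fin (r + 1) → ∀ x : M, TangentSpace (𝓡 n) x) (x : M) : V :=
  mvfderiv (𝓡 n) (T (Fin.tail X)) x (X 0 x) -
    ∑ j : Fin r, T (Function.update (Fin.tail X) j (fun y => cov (X j.succ) y (X 0 y))) x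

variable {cov} {r : ℕ} {T : (Fin r → ∀ x : M, TangentSpace (𝓡 n) x) → M → V}
  (hT : IsTensorial T) {x : M} {X : Fin r → ∀ x : M, TangentSpace (𝓡 n) x}
  (hX : ∀ i, SmoothFieldNear (𝓡 n) (X i) x) (j : Fin r) {a : M → ℝ}
  {W Y Z : ∀ x : M, TangentSpace (𝓡 n) x} (ha : SmoothNear (𝓡 n) a x)
  (hY : SmoothFieldNear (𝓡 n) Y x) (hZ : SmoothFieldNear (𝓡 n) Z x)

include hT hX ha hY hZ

theorem IsTensorial.mvfderiv_update_smul_add (v : TangentSpace (𝓡 n) x) :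
    mvfderiv (𝓡 n) (T (Function.update X j (a • Y + Z))) x v =
      mvfderiv (𝓡 n) a x v • T (Function.update X j Y) x +
        (a x • mvfderiv (𝓡 n) (T (Function.update X j Y)) x v +
          mvfderiv (𝓡 n) (T (Function.update X j Z)) x v) := by
  have hTY := (hT.smooth (.update hX j hY)).mdifferentiableAt
  have hTZ := (hT.smooth (.update hX j hZ)).mdifferentiableAt
  have heq : T (Function.update X j (a • Y + Z)) =ᶠ[𝓝 x]
      a • T (Function.update X j Y) + T (Function.update X j Z) := by
    filter_upwards [eventually_all.2 fun k => (hX k).eventually, ha.eventually, hY.eventually,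
      hZ.eventually] with y hXy hay hYy hZy
    exact hT.smul_add hXy j hay hYy hZy
  rw [mvfderiv_congr_of_eventuallyEq heq,
    mvfderiv_add (ha.mdifferentiableAt.smul hTY) hTZ, mvfderiv_smul ha.mdifferentiableAt hTY]
  simp only [add_apply, smul_apply, ContinuousLinearMap.smulRight_apply]
  module

variable [T2Space M] [cov.ContMDiffCovariantDerivative ∞] (hW : SmoothFieldNear (𝓡 n) W x)

include hW

theorem IsTensorial.update_cov_smul_add :
    T (Function.update X j (fun y => cov (a • Y + Z) y (W y))) x =
      mvfderiv (𝓡 n) a x (W x) • T (Function.update X j Y) x +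
        (a x • T (Function.update X j (fun y => cov Y y (W y))) x +
          T (Function.update X j (fun y => cov Z y (W y))) x) := by
  have hcovY := hW.covariant cov hY
  have hcovZ := hW.covariant cov hZ
  rw [hT.update_congr hX j
      (.add (.smul (ha.mvfderiv hW) hY) (.add (.smul ha hcovY) hcovZ))
      (eventually_cov_smul_add cov ha hY hZ),
    hT.smul_add hX j (ha.mvfderiv hW) hY (.add (.smul ha hcovY) hcovZ),
    hT.smul_add hX j ha hcovY hcovZ]

end CovStep

variable [T2Space M]

theorem IsTensorial.covStep_correction_smul_add {cov : LinearConnection n M}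
    [cov.ContMDiffCovariantDerivative ∞] {r : ℕ}
    {T : (Fin r → ∀ x : M, TangentSpace (𝓡 n) x) → M → V} (hT : IsTensorial T) {x : M}
    {X : Fin (r + 1) → ∀ x : M, TangentSpace (𝓡 n) x} (hX : ∀ i, SmoothFieldNear (𝓡 n) (X i) x)
    (j k : Fin r) {a : M → ℝ} {Y Z : ∀ x : M, TangentSpace (𝓡 n) x} (ha : SmoothNear (𝓡 n) a x)
    (hY : SmoothFieldNear (𝓡 n) Y x) (hZ : SmoothFieldNear (𝓡 n) Z x) :
    T (Function.update (Function.update (Fin.tail X) j (a • Y + Z)) k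
        (fun y => cov (Function.update X j.succ (a • Y + Z) k.succ) y (X 0 y))) x =
      (if k = j then mvfderiv (𝓡 n) a x (X 0 x) • T (Function.update (Fin.tail X) j Y) x else 0) +
      (a x • T (Function.update (Function.update (Fin.tail X) j Y) k
          (fun y => cov (Function.update X j.succ Y k.succ) y (X 0 y))) x +
        T (Function.update (Function.update (Fin.tail X) j Z) k
          (fun y => cov (Function.update X j.succ Z k.succ) y (X 0 y))) x) := by
  have htail : ∀ i, SmoothFieldNear (𝓡 n) (Fin.tail X i) x := fun i => hX i.succ
  by_cases hkj : k = j
  · subst hkj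
    simpa using hT.update_cov_smul_add htail k ha hY hZ (hX 0)
  · simp only [Function.update_of_ne ((Fin.succ_injective _).ne hkj), if_neg hkj, zero_add,
      Function.update_comm (Ne.symm hkj)]
    exact hT.smul_add (.update htail k ((hX 0).covariant cov (hX k.succ))) j ha hY hZ

theorem IsTensorial.covStep (cov : LinearConnection n M) [cov.ContMDiffCovariantDerivative ∞]
    {r : ℕ} {T : (Fin r → ∀ x : M, TangentSpace (𝓡 n) x) → M → V} (hT : IsTensorial T) :
    IsTensorial (covStep cov T) where
  smooth {x X} hX := by
    have htail : ∀ i, SmoothFieldNear (𝓡 n) (Fin.tail X i) x := fun i => hX i.succ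
    exact ((hT.smooth htail).mvfderiv (hX 0)).sub (.sum fun j _ =>
      hT.smooth (.update htail j ((hX 0).covariant cov (hX j.succ))))
  smul_add {x X} hX j a Y Z ha hY hZ := by
    have htail : ∀ i, SmoothFieldNear (𝓡 n) (Fin.tail X i) x := fun i => hX i.succ
    refine Fin.cases ?_ (fun i => ?_) j
    · have hcorrection : ∀ k : Fin r, T (Function.update (Fin.tail X) k
          (fun y => a y • cov (X k.succ) y (Y y) + cov (X k.succ) y (Z y))) x =
          a x • T (Function.update (Fin.tail X) k (fun y => cov (X k.succ) y (Y y))) x +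
            T (Function.update (Fin.tail X) k (fun y => cov (X k.succ) y (Z y))) x := fun k =>
        hT.smul_add htail k ha (hY.covariant cov (hX k.succ)) (hZ.covariant cov (hX k.succ))
      simp only [Quantization.covStep, Fin.tail_update_zero, Function.update_self, ne_eq,
        Fin.succ_ne_zero, not_false_eq_true, Function.update_of_ne, hcorrection,
        Finset.sum_add_distrib, ← Finset.smul_sum, Pi.add_apply, Pi.smul_apply', map_add, map_smul]
      module
    · have hzero : ∀ W, Function.update X i.succ W 0 = X 0 := fun W =>
        Function.update_of_ne (Fin.succ_ne_zero i).symm _ _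
      simp only [Quantization.covStep, Fin.tail_update_succ, hzero,
        hT.covStep_correction_smul_add hX i _ ha hY hZ,
        hT.mvfderiv_update_smul_add htail i ha hY hZ, Finset.sum_add_distrib, ← Finset.smul_sum,
        Finset.sum_ite_eq', Finset.mem_univ, if_true]
      module

theorem isTensorial_iteratedCov (cov : LinearConnection n M) [cov.ContMDiffCovariantDerivative ∞]
    {f : M → ℂ} (hf : ContMDiff (𝓡 n) 𝓘(ℝ, ℂ) ∞ f) (r : ℕ) : IsTensorial (iteratedCov cov f r) := by
  induction r with
  | zero => exact ⟨fun _ => .of_contMDiff hf, fun _ j => j.elim0⟩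
  | succ r ih => exact ih.covStep cov

end Tensoriality

/-! ### The contraction of a contravariant tensor field with the iterated covariant differential -/

section Contraction

open Filter Topology

variable {n : ℕ} {M : Type*} [TopologicalSpace M] [ChartedSpace (EuclideanSpace ℝ (Fin n)) M]
  [IsManifold (𝓡 n) ∞ M]

omit [IsManifold (𝓡 n) ∞ M] in
theorem eq_sum_dualBasis {x : M} (ξ : Cotangent n M x) :
    ξ = ∑ i, ξ (tangentBasis x i) • dualBasis x i := by
  ext v
  have h := congrArg (fun φ => φ v) ((tangentBasis x).sum_dual_apply_smul_coord ξ.toLinearMap)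
  simpa [dualBasis] using! h.symm

variable (n) in
/-- The `i`-th coordinate of the preferred chart at `x₀`, cut off to a function on `M`. -/
def coordFun (x₀ : M) (i : Fin n) : M → ℝ :=
  bumpPullback x₀ fun u : EuclideanSpace ℝ (Fin n) => u i

theorem contMDiff_coordFun [T2Space M] (x₀ : M) (i : Fin n) :
    ContMDiff (𝓡 n) 𝓘(ℝ, ℝ) ∞ (coordFun n x₀ i) :=
  contMDiff_bumpPullback x₀ (EuclideanSpace.proj i : EuclideanSpace ℝ (Fin n) →L[ℝ] ℝ).contDiff

theorem coordCoeff_apply_of_mem {x₀ x : M}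
    (hx : x ∈ (chartAt (EuclideanSpace ℝ (Fin n)) x₀).source) (i : Fin n)
    (v : TangentSpace (𝓡 n) x) :
    coordCoeff n x₀ i x v = EuclideanSpace.proj (𝕜 := ℝ) i
      (mfderiv (𝓡 n) 𝓘(ℝ, EuclideanSpace ℝ (Fin n)) (extChartAt (𝓡 n) x₀) x v) := by
  classical
  let e := trivializationAt (EuclideanSpace ℝ (Fin n)) (TangentSpace (𝓡 n) : M → Type) x₀
  have hbase : x ∈ e.baseSet := hx
  have hcoeff := Bundle.Trivialization.localFrameCoeff_eq_coeff (I := 𝓡 n)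
    (b := (EuclideanSpace.basisFun (Fin n) ℝ).toBasis) (i := i) e
    (s := fun y => if h : y = x then h ▸ v else 0) hbase
  have hcoeff_proj : coordCoeff n x₀ i x v =
      EuclideanSpace.proj (𝕜 := ℝ) i (e.continuousLinearMapAt ℝ x v) := by
    rw [e.continuousLinearMapAt_apply (R := ℝ), e.linearMapAt_apply, if_pos hbase]
    simpa using! hcoeff
  rw [hcoeff_proj, TangentBundle.continuousLinearMapAt_trivializationAt hx]
  rfl

theorem eventually_differential_coordFun (x₀ : M) :
    ∀ᶠ x in 𝓝 x₀, ∀ (i : Fin n) (v : TangentSpace (𝓡 n) x),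
      differential n (coordFun n x₀ i) x v = coordCoeff n x₀ i x v := by
  have hcoord : ∀ᶠ x in 𝓝 x₀, ∀ i : Fin n, coordFun n x₀ i =ᶠ[𝓝 x]
      fun y => extChartAt (𝓡 n) x₀ y i :=
    eventually_all.2 fun i => eventually_eventually_nhds.2 (bumpPullback_eventuallyEq x₀ _)
  filter_upwards [hcoord, chart_source_mem_nhds (EuclideanSpace ℝ (Fin n)) x₀] with x hx hsource i v
  let pr : EuclideanSpace ℝ (Fin n) →L[ℝ] ℝ := EuclideanSpace.proj i
  calc differential n (coordFun n x₀ i) x v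
      = mvfderiv (𝓡 n) (fun y => pr (extChartAt (𝓡 n) x₀ y)) x v :=
        mvfderiv_congr_of_eventuallyEq (hx i) v
    _ = coordCoeff n x₀ i x v := by
        rw [mvfderiv_comp_extChartAt x₀ pr.differentiable hsource, pr.fderiv,
          coordCoeff_apply_of_mem hsource]

theorem contraction_symCovAt {r : ℕ} {x : M}
    {A : MultilinearMap ℝ (fun _ : Fin r => Cotangent n M x) ℂ}
    (hA : ∀ (σ : Equiv.Perm (Fin r)) (ξ : Fin r → Cotangent n M x), A (fun i => ξ (σ i)) = A ξ)
    (cov : LinearConnection n M) (f : M → ℂ) :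
    contraction A (symCovAt cov f r x) = contraction A (iteratedCovAt cov f r x) := by
  have hperm : ∀ σ : Equiv.Perm (Fin r),
      contraction A (fun v => iteratedCovAt cov f r x fun k => v (σ k)) =
        contraction A (iteratedCovAt cov f r x) := by
    intro σ
    refine Fintype.sum_equiv (σ.symm.arrowCongr (Equiv.refl _)) _ _ fun i => ?_
    simp only [Equiv.arrowCongr_apply, Equiv.symm_symm, Equiv.coe_refl, Function.comp_apply, id]
    rw [← hA σ fun k => dualBasis x (i k)]
  calc contraction A (symCovAt cov f r x)
      = (r.factorial : ℂ)⁻¹ * ∑ σ : Equiv.Perm (Fin r),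
          contraction A (fun v => iteratedCovAt cov f r x fun k => v (σ k)) := by
        simp only [contraction, symCovAt]
        rw [Finset.sum_comm, Finset.mul_sum]
        refine Finset.sum_congr rfl fun i _ => ?_
        rw [← Finset.mul_sum, mul_left_comm]
    _ = contraction A (iteratedCovAt cov f r x) := by
        simp only [hperm, Finset.sum_const, Finset.card_univ, Fintype.card_perm, Fintype.card_fin,
          nsmul_eq_mul]
        rw [inv_mul_cancel_left₀ (by exact_mod_cast r.factorial_ne_zero)]

variable [T2Space M] (cov : LinearConnection n M) [cov.ContMDiffCovariantDerivative ∞]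

theorem eventually_contraction_eq_sum {f : M → ℂ} (hf : ContMDiff (𝓡 n) 𝓘(ℝ, ℂ) ∞ f) {r : ℕ}
    (A : ∀ x : M, MultilinearMap ℝ (fun _ : Fin r => Cotangent n M x) ℂ) (x₀ : M) :
    ∀ᶠ x in 𝓝 x₀, contraction (A x) (iteratedCovAt cov f r x) =
      ∑ K : Fin r → Fin n, A x (fun l => differential n (coordFun n x₀ (K l)) x) *
        iteratedCov cov f r (fun l => coordFrame n x₀ (K l)) x := by
  filter_upwards [eventually_differential_coordFun (n := n) x₀,
    eventually_eq_sum_coordFrame (n := n) x₀,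
    eventually_all.2 fun i => (smoothFieldNear_coordFrame (n := n) x₀ i).eventually]
    with x hdiff hsum hsmooth
  have hchange := sum_mul_eq_sum_mul_of_change_of_basis (A x)
    ((isTensorial_iteratedCov cov hf r).multilinearAt x) (b := tangentBasis x) (β := dualBasis x)
    (c := fun k => coordFrame n x₀ k x) (γ := fun k => differential n (coordFun n x₀ k) x)
    (fun k i => coordCoeff n x₀ k x (tangentBasis x i))
    (fun k => by simpa only [hdiff] using eq_sum_dualBasis (differential n (coordFun n x₀ k) x))
    (fun i => hsum _)
  refine hchange.trans (Finset.sum_congr rfl fun K _ => ?_)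
  rw [(isTensorial_iteratedCov cov hf r).multilinearAt_apply fun i => hsmooth (K i)]

theorem contMDiff_contraction {f : M → ℂ} (hf : ContMDiff (𝓡 n) 𝓘(ℝ, ℂ) ∞ f) {r : ℕ}
    (A : symTensor n M r) :
    ContMDiff (𝓡 n) 𝓘(ℝ, ℂ) ∞ (fun x => contraction (A.1 x) (symCovAt cov f r x)) := by
  intro x₀
  have hsum : SmoothNear (𝓡 n) (fun x => ∑ K : Fin r → Fin n,
      A.1 x (fun l => differential n (coordFun n x₀ (K l)) x) *
        iteratedCov cov f r (fun l => coordFrame n x₀ (K l)) x) x₀ :=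
    .sum fun K _ => .mul (.of_contMDiff (A.2.2 _ fun i => contMDiff_coordFun x₀ (K i)))
      ((isTensorial_iteratedCov cov hf r).smooth fun i => smoothFieldNear_coordFrame x₀ (K i))
  refine hsum.self_of_nhds.congr_of_eventuallyEq ?_
  filter_upwards [eventually_contraction_eq_sum cov hf A.1 x₀] with x hx
  rw [contraction_symCovAt (A.2.1 x), hx]

end Contraction

/-! ### Covariant differentials of powers -/

section DvdNear

open Filter Topology

variable {E H M : Type*} [NormedAddCommGroup E] [NormedSpace ℝ E] [TopologicalSpace H]
  {I : ModelWithCorners ℝ E H} [TopologicalSpace M] [ChartedSpace H M] {x : M}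

theorem mvfderiv_mul_apply {A : Type*} [NormedCommRing A] [NormedAlgebra ℝ A] {f g : M → A}
    (hf : MDifferentiableAt I 𝓘(ℝ, A) f x) (hg : MDifferentiableAt I 𝓘(ℝ, A) g x)
    (v : TangentSpace I x) :
    mvfderiv I (fun y => f y * g y) x v = f x * mvfderiv I g x v + mvfderiv I f x v * g x := by
  have hderiv := congrArg (fun L => L v) (hf.hasMFDerivAt.mul hg.hasMFDerivAt).mfderiv
  exact hderiv.trans (congrArg (f x * mvfderiv I g x v + ·) (mul_comm _ _))

theorem mvfderiv_const_mul_apply {A : Type*} [NormedCommRing A] [NormedAlgebra ℝ A] (c : A)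
    {f : M → A} (hf : MDifferentiableAt I 𝓘(ℝ, A) f x) (v : TangentSpace I x) :
    mvfderiv I (fun y => c * f y) x v = c * mvfderiv I f x v := by
  rw [mvfderiv_mul_apply mdifferentiableAt_const hf, mvfderiv_const, zero_apply, zero_mul,
    add_zero]

theorem mvfderiv_pow_apply {A : Type*} [NormedCommRing A] [NormedAlgebra ℝ A] {g : M → A}
    (hg : SmoothNear I g x) (m : ℕ) (v : TangentSpace I x) :
    mvfderiv I (fun y => g y ^ (m + 1)) x v = (m + 1) * g x ^ m * mvfderiv I g x v := by
  induction m with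
  | zero => simp
  | succ m ih =>
    simp only [pow_succ _ (m + 1)]
    rw [mvfderiv_mul_apply (hg.pow _).mdifferentiableAt hg.mdifferentiableAt, ih]
    push_cast
    ring

variable (I) in
/-- Near `x`, the function `f` is a multiple of `a` with a smooth factor. -/
def DvdNear (a f : M → ℂ) (x : M) : Prop :=
  ∃ h : M → ℂ, SmoothNear I h x ∧ f =ᶠ[𝓝 x] fun y => a y * h y

namespace DvdNear

variable {a f g : M → ℂ}

theorem mul_right {h : M → ℂ} (hh : SmoothNear I h x) : DvdNear I a (fun y => a y * h y) x :=
  ⟨h, hh, .rfl⟩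

theorem congr (hf : DvdNear I a f x) (h : g =ᶠ[𝓝 x] f) : DvdNear I a g x :=
  let ⟨k, hk, hfk⟩ := hf
  ⟨k, hk, h.trans hfk⟩

theorem add (hf : DvdNear I a f x) (hg : DvdNear I a g x) :
    DvdNear I a (fun y => f y + g y) x := by
  obtain ⟨h, hh, hfh⟩ := hf
  obtain ⟨k, hk, hgk⟩ := hg
  refine ⟨_, hh.add hk, ?_⟩
  filter_upwards [hfh, hgk] with y hfy hgy
  rw [hfy, hgy, mul_add]

theorem neg (hf : DvdNear I a f x) : DvdNear I a (fun y => -f y) x := by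
  obtain ⟨h, hh, hfh⟩ := hf
  refine ⟨_, (SmoothNear.const (-1)).mul hh, ?_⟩
  filter_upwards [hfh] with y hfy
  rw [hfy]
  ring

theorem sum {ι : Type*} [Fintype ι] {F : ι → M → ℂ} (hF : ∀ i, DvdNear I a (F i) x) :
    DvdNear I a (fun y => ∑ i, F i y) x := by
  choose h hh hFh using hF
  refine ⟨_, .sum fun i (_ : i ∈ Finset.univ) => hh i, ?_⟩
  filter_upwards [eventually_all.2 hFh] with y hy
  simp only [hy, Finset.mul_sum]

theorem smoothNear (ha : SmoothNear I a x) (hf : DvdNear I a f x) : SmoothNear I f x :=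
  let ⟨_, hh, hfh⟩ := hf
  (ha.mul hh).congr hfh

theorem of_pow_succ (hg : SmoothNear I g x) {m : ℕ} (hf : DvdNear I (fun y => g y ^ (m + 1)) f x) :
    DvdNear I (fun y => g y ^ m) f x := by
  obtain ⟨h, hh, hfh⟩ := hf
  exact ⟨_, hg.mul hh, by simpa only [pow_succ, mul_assoc] using hfh⟩

theorem mvfderiv_of_pow_succ [IsManifold I ∞ M] {X : ∀ x : M, TangentSpace I x}
    (hg : SmoothNear I g x) (hX : SmoothFieldNear I X x) {m : ℕ}
    (hf : DvdNear I (fun y => g y ^ (m + 1)) f x) :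
    DvdNear I (fun y => g y ^ m) (fun y => mvfderiv I f y (X y)) x := by
  obtain ⟨h, hh, hfh⟩ := hf
  refine ⟨fun y => (m + 1 : ℂ) * (mvfderiv I g y (X y) * h y) + g y * mvfderiv I h y (X y),
    ((SmoothNear.const _).mul ((hg.mvfderiv hX).mul hh)).add (hg.mul (hh.mvfderiv hX)), ?_⟩
  filter_upwards [hfh.eventuallyEq_nhds, hg.eventually, hh.eventually] with y hfy hgy hhy
  rw [mvfderiv_congr_of_eventuallyEq hfy,
    mvfderiv_mul_apply (hgy.pow _).mdifferentiableAt hhy.mdifferentiableAt, mvfderiv_pow_apply hgy]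
  ring

end DvdNear

end DvdNear

section Powers

open Filter Topology

variable {n : ℕ} {M : Type*} [TopologicalSpace M] [ChartedSpace (EuclideanSpace ℝ (Fin n)) M]
  [IsManifold (𝓡 n) ∞ M] [T2Space M] (cov : LinearConnection n M)
  [cov.ContMDiffCovariantDerivative ∞] {x : M}

theorem iteratedCov_const_mul_add (c : ℂ) {f g : M → ℂ} (hf : ContMDiff (𝓡 n) 𝓘(ℝ, ℂ) ∞ f)
    (hg : ContMDiff (𝓡 n) 𝓘(ℝ, ℂ) ∞ g) {r : ℕ} {X : Fin r → ∀ x : M, TangentSpace (𝓡 n) x}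
    (hX : ∀ i, SmoothFieldNear (𝓡 n) (X i) x) :
    iteratedCov cov (fun y => c * f y + g y) r X x =
      c * iteratedCov cov f r X x + iteratedCov cov g r X x := by
  induction r generalizing x with
  | zero => rfl
  | succ r ih =>
    have htail : ∀ i, SmoothFieldNear (𝓡 n) (Fin.tail X i) x := fun i => hX i.succ
    have hfT := (isTensorial_iteratedCov cov hf r).smooth htail
    have hgT := (isTensorial_iteratedCov cov hg r).smooth htail
    have hnear : iteratedCov cov (fun y => c * f y + g y) r (Fin.tail X) =ᶠ[𝓝 x] fun y =>
        c * iteratedCov cov f r (Fin.tail X) y + iteratedCov cov g r (Fin.tail X) y := by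
      filter_upwards [eventually_all.2 fun i => (htail i).eventually] with y hy using ih hy
    have hderiv := (mvfderiv_congr_of_eventuallyEq hnear (X 0 x)).trans <| by
      rw [mvfderiv_fun_add ((SmoothNear.const c).mul hfT).mdifferentiableAt hgT.mdifferentiableAt,
        add_apply, mvfderiv_const_mul_apply c hfT.mdifferentiableAt]
    have hcorrection := fun j : Fin r =>
      ih (SmoothFieldNear.update htail j ((hX 0).covariant cov (hX j.succ)))
    simp only [iteratedCov, hderiv, hcorrection, Finset.sum_add_distrib, ← Finset.mul_sum]
    ring

theorem dvdNear_covStep_sub {g : M → ℂ} (hg : SmoothNear (𝓡 n) g x) {k m : ℕ} {c : ℂ}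
    {T : (Fin k → ∀ x : M, TangentSpace (𝓡 n) x) → M → ℂ}
    (hT : ∀ {X}, (∀ i, SmoothFieldNear (𝓡 n) (X i) x) → DvdNear (𝓡 n) (fun y => g y ^ (m + 2))
      (fun y => T X y - c * g y ^ (m + 1) * ∏ i, mvfderiv (𝓡 n) g y (X i y)) x)
    {X : Fin (k + 1) → ∀ x : M, TangentSpace (𝓡 n) x}
    (hX : ∀ i, SmoothFieldNear (𝓡 n) (X i) x) :
    DvdNear (𝓡 n) (fun y => g y ^ (m + 1)) (fun y => covStep cov T X y -
      c * (m + 1) * g y ^ m * ∏ i, mvfderiv (𝓡 n) g y (X i y)) x := by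
  have htail : ∀ i, SmoothFieldNear (𝓡 n) (Fin.tail X i) x := fun i => hX i.succ
  have hprod : ∀ {Z : Fin k → ∀ x : M, TangentSpace (𝓡 n) x},
      (∀ i, SmoothFieldNear (𝓡 n) (Z i) x) →
        SmoothNear (𝓡 n) (fun y => ∏ i, mvfderiv (𝓡 n) g y (Z i y)) x :=
    fun hZ => .prod fun i _ => hg.mvfderiv (hZ i)
  have hcorrection : ∀ j, DvdNear (𝓡 n) (fun y => g y ^ (m + 1))
      (T (Function.update (Fin.tail X) j fun y => cov (X j.succ) y (X 0 y))) x := fun j => by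
    have hupdate := SmoothFieldNear.update htail j ((hX 0).covariant cov (hX j.succ))
    refine ((hT hupdate).of_pow_succ hg |>.add (.mul_right ((SmoothNear.const c).mul
      (hprod hupdate)))).congr (.of_forall fun y => ?_)
    ring
  have hremainder := (hT htail).mvfderiv_of_pow_succ hg (hX 0)
  have hleading : DvdNear (𝓡 n) (fun y => g y ^ (m + 1)) (fun y => g y ^ (m + 1) * (c *
      mvfderiv (𝓡 n) (fun z => ∏ i, mvfderiv (𝓡 n) g z (Fin.tail X i z)) y (X 0 y))) x :=
    .mul_right ((SmoothNear.const c).mul ((hprod htail).mvfderiv (hX 0)))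
  refine ((hremainder.add hleading).add (DvdNear.sum hcorrection).neg).congr ?_
  filter_upwards [((hT htail).smoothNear (hg.pow _)).eventually, hg.eventually,
    (hprod htail).eventually] with y hremy hgy hprody
  have hsplit : T (Fin.tail X) = fun z =>
      (T (Fin.tail X) z - c * g z ^ (m + 1) * ∏ i, mvfderiv (𝓡 n) g z (Fin.tail X i z)) +
        c * (g z ^ (m + 1) * ∏ i, mvfderiv (𝓡 n) g z (Fin.tail X i z)) := by
    funext z
    ring
  have hlead := (hgy.pow (m + 1)).mul hprody
  have hderiv := congrArg (fun F => mvfderiv (𝓡 n) F y (X 0 y)) hsplit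
  rw [mvfderiv_fun_add hremy.mdifferentiableAt ((SmoothNear.const c).mul hlead).mdifferentiableAt,
    add_apply, mvfderiv_const_mul_apply c hlead.mdifferentiableAt,
    mvfderiv_mul_apply (hgy.pow _).mdifferentiableAt hprody.mdifferentiableAt,
    mvfderiv_pow_apply hgy] at hderiv
  rw [covStep, hderiv, Fin.prod_univ_succ]
  simp only [Fin.tail]
  ring

theorem dvdNear_iteratedCov_pow_sub {g : M → ℂ} (hg : SmoothNear (𝓡 n) g x) (k m : ℕ)
    {X : Fin k → ∀ x : M, TangentSpace (𝓡 n) x} (hX : ∀ i, SmoothFieldNear (𝓡 n) (X i) x) :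
    DvdNear (𝓡 n) (fun y => g y ^ (m + 1)) (fun y =>
      iteratedCov cov (fun z => g z ^ (k + m)) k X y -
        (k + m).descFactorial k * g y ^ m * ∏ i, mvfderiv (𝓡 n) g y (X i y)) x := by
  induction k generalizing m with
  | zero => exact (DvdNear.mul_right (.const 0)).congr (.of_forall fun y => by simp [iteratedCov])
  | succ k ih =>
    have hfactorial : ((k + 1 + m).descFactorial (k + 1) : ℂ) =
        (k + (m + 1)).descFactorial k * (m + 1) := by
      rw [show k + 1 + m = k + (m + 1) by ring, Nat.descFactorial_succ, Nat.add_sub_cancel_left]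
      push_cast
      ring
    rw [hfactorial, show k + 1 + m = k + (m + 1) by ring]
    exact dvdNear_covStep_sub cov hg (ih (m + 1)) hX

theorem iteratedCovAt_pow (g : SmoothFun n M) (hg : g ∈ vanishingIdeal n x) (k m : ℕ)
    (v : Fin k → TangentSpace (𝓡 n) x) :
    iteratedCovAt cov (g ^ (k + m) : SmoothFun n M) k x v =
      (k + m).descFactorial k * (0 : ℂ) ^ m * ∏ i, mvfderiv (𝓡 n) g x (v i) := by
  have hg0 : g x = 0 := hg
  have hfun : ((g ^ (k + m) : SmoothFun n M) : M → ℂ) = fun y => g y ^ (k + m) :=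
    funext fun y => SmoothFun.pow_apply g _ y
  obtain ⟨h, -, hh⟩ := dvdNear_iteratedCov_pow_sub cov (.of_contMDiff g.contMDiff) k m
    fun i => SmoothFieldNear.extend (v i)
  have hx := hh.self_of_nhds
  simp only [hg0, FiberBundle.extend_apply_self, zero_pow (Nat.succ_ne_zero m), zero_mul] at hx
  rw [hfun]
  exact sub_eq_zero.1 hx

theorem iteratedCovAt_pow_of_lt {g : SmoothFun n M} (hg : g ∈ vanishingIdeal n x)
    {k s : ℕ} (hks : k < s) (v : Fin k → TangentSpace (𝓡 n) x) :
    iteratedCovAt cov (g ^ s : SmoothFun n M) k x v = 0 := by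
  obtain ⟨m, rfl⟩ := Nat.exists_eq_add_of_lt hks
  rw [add_assoc, iteratedCovAt_pow cov g hg, zero_pow (Nat.succ_ne_zero m), mul_zero, zero_mul]

theorem iteratedCovAt_pow_self {g : SmoothFun n M} (hg : g ∈ vanishingIdeal n x) {k : ℕ}
    (v : Fin k → TangentSpace (𝓡 n) x) :
    iteratedCovAt cov (g ^ k : SmoothFun n M) k x v =
      k.factorial * ∏ i, mvfderiv (𝓡 n) g x (v i) := by
  simpa [Nat.descFactorial_self] using iteratedCovAt_pow cov g hg k 0 v

end Powers

/-! ### Quantization of tensor fields -/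

section Quantize

variable {n : ℕ} {M : Type*} [TopologicalSpace M] [ChartedSpace (EuclideanSpace ℝ (Fin n)) M]
  {r : ℕ}

theorem symTensor_ext {A B : symTensor n M r}
    (h : ∀ (x : M) (ξ : Fin r → Cotangent n M x), A.1 x ξ = B.1 x ξ) : A = B :=
  Subtype.ext (funext fun x => MultilinearMap.ext (h x))

theorem symTensor_eq_zero_of_diagonal {A : symTensor n M r}
    (h : ∀ (x : M) (ξ : Cotangent n M x), A.1 x (fun _ => ξ) = 0) : A = 0 :=
  symTensor_ext fun x ξ => eq_zero_of_diagonal_eq_zero (A.1 x) (A.2.1 x) (h x) ξ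

variable [IsManifold (𝓡 n) ∞ M] [T2Space M] (cov : LinearConnection n M)
  [cov.ContMDiffCovariantDerivative ∞] {x : M}

theorem contraction_symCovAt_smul_add (A : symTensor n M r) (x : M) (c : ℂ) (f g : SmoothFun n M) :
    contraction (A.1 x) (symCovAt cov (c • f + g : SmoothFun n M) r x) =
      c * contraction (A.1 x) (symCovAt cov f r x) +
        contraction (A.1 x) (symCovAt cov g r x) := by
  simp only [contraction_symCovAt (A.2.1 x)]
  simp only [contraction, Finset.mul_sum, ← Finset.sum_add_distrib]
  refine Finset.sum_congr rfl fun i _ => ?_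
  rw [← mul_left_comm, ← mul_add]
  exact congrArg _ (iteratedCov_const_mul_add cov c f.contMDiff g.contMDiff
    fun _ => SmoothFieldNear.extend _)

/-- The functional `f ↦ ⟨A, ∇^r_sym f⟩(x)`, to which the algebra of functionals that vanish on
powers of `𝔪_x` applies. -/
def contractionFunctional (A : symTensor n M r) (x : M) : SmoothFun n M →ₗ[ℂ] ℂ where
  toFun f := contraction (A.1 x) (symCovAt cov f r x)
  map_add' f g := by simpa using contraction_symCovAt_smul_add cov A x 1 f g
  map_smul' c f := by
    have hzero : contraction (A.1 x) (symCovAt cov (0 : SmoothFun n M) r x) = 0 := by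
      simpa using contraction_symCovAt_smul_add cov A x (-1) 0 0
    simpa [hzero] using contraction_symCovAt_smul_add cov A x c f 0

theorem contractionFunctional_pow_of_lt {s : ℕ} (hrs : r < s) (A : symTensor n M r)
    {g : SmoothFun n M} (hg : g ∈ vanishingIdeal n x) :
    contractionFunctional cov A x (g ^ s) = 0 := by
  change contraction _ _ = 0
  rw [contraction_symCovAt (A.2.1 x)]
  simp only [contraction, iteratedCovAt_pow_of_lt cov hg hrs,
    mul_zero, Finset.sum_const_zero]

theorem contractionFunctional_pow_self (A : symTensor n M r) {g : SmoothFun n M}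
    (hg : g ∈ vanishingIdeal n x) :
    contractionFunctional cov A x (g ^ r) = r.factorial * ∑ i : Fin r → Fin n,
      A.1 x (fun k => dualBasis x (i k)) * ∏ k, mvfderiv (𝓡 n) g x (tangentBasis x (i k)) := by
  change contraction _ _ = _
  rw [contraction_symCovAt (A.2.1 x)]
  simp only [contraction, iteratedCovAt_pow_self cov hg,
    Finset.mul_sum, mul_left_comm]

theorem contractionFunctional_coordSection_pow (A : symTensor n M r) (x : M)
    (ξ : Cotangent n M x) :
    contractionFunctional cov A x (coordSection n x ξ ^ r) =
      r.factorial * A.1 x (fun _ => ξ) := by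
  rw [contractionFunctional_pow_self cov A (coordSection_mem_vanishingIdeal x ξ)]
  conv_rhs => rw [eq_sum_dualBasis ξ, MultilinearMap.map_sum]
  simp only [MultilinearMap.map_smul_univ, Complex.real_smul, mvfderiv_coordSection,
    Complex.ofReal_prod, mul_comm]

variable (ħ : ℝ)

/-- The quantized `f ↦ (-iħ)^r ⟨A, ∇^r_sym f⟩` of a homogeneous tensor field `A`. -/
def quantizeHom (r : ℕ) : symTensor n M r →ₗ[ℂ] SmoothFun n M →ₗ[ℂ] SmoothFun n M :=
  (-Complex.I * ħ) ^ r • LinearMap.mk₂ ℂ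
    (fun A f => SmoothFun.mk (fun x => contractionFunctional cov A x f)
      (contMDiff_contraction cov f.contMDiff A))
    (fun _ _ _ => SmoothFun.ext fun _ =>
      (Finset.sum_congr rfl fun _ _ => add_mul _ _ _).trans Finset.sum_add_distrib)
    (fun _ _ _ => SmoothFun.ext fun _ =>
      (Finset.sum_congr rfl fun _ _ => mul_assoc _ _ _).trans (Finset.mul_sum _ _ _).symm)
    (fun A f g => SmoothFun.ext fun x => map_add (contractionFunctional cov A x) f g)
    (fun c A f => SmoothFun.ext fun x => map_smul (contractionFunctional cov A x) c f)

theorem quantizeHom_apply (A : symTensor n M r) (f : SmoothFun n M) (x : M) :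
    quantizeHom cov ħ r A f x = (-Complex.I * ħ) ^ r * contractionFunctional cov A x f := rfl

theorem quantizeHom_apply_mem_vanishingIdeal (A : symTensor n M r) {f : SmoothFun n M}
    (hf : f ∈ vanishingIdeal n x ^ (r + 1)) :
    quantizeHom cov ħ r A f ∈ vanishingIdeal n x := by
  rw [mem_vanishingIdeal, quantizeHom_apply, map_eq_zero_of_map_pow_succ_eq_zero (fun g hg =>
    contractionFunctional_pow_of_lt cov r.lt_succ_self A hg) hf, mul_zero]

/-- The quantized of a tensor field, as a linear map in the tensor field. -/
def quantize : SymTensor n M →ₗ[ℂ] SmoothFun n M →ₗ[ℂ] SmoothFun n M :=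
  DFinsupp.lsum ℂ (quantizeHom cov ħ)

open Classical in
theorem quantize_eq_sum (Φ : SymTensor n M) :
    quantize cov ħ Φ = ∑ r ∈ Φ.support, quantizeHom cov ħ r (Φ r) :=
  DFinsupp.sumAddHom_apply _ Φ

open Classical in
theorem quantize_apply (Φ : SymTensor n M) (f : SmoothFun n M) (x : M) :
    quantize cov ħ Φ f x = ∑ r ∈ Φ.support, quantizeHom cov ħ r (Φ r) f x := by
  rw [quantize_eq_sum, LinearMap.sum_apply, SmoothFun.sum_apply]

theorem isQuantized_iff (Φ : SymTensor n M) (P : SmoothFun n M →ₗ[ℂ] SmoothFun n M) :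
    IsQuantized ħ cov Φ P ↔ P = quantize cov ħ Φ := by
  classical
  refine ⟨fun hP => LinearMap.ext fun f => SmoothFun.ext fun x => ?_, ?_⟩
  · exact (hP f x).trans (quantize_apply cov ħ Φ f x).symm
  · rintro rfl f x
    exact quantize_apply cov ħ Φ f x

theorem quantize_mem_diffOp (Φ : SymTensor n M) : quantize cov ħ Φ ∈ diffOp n M := by
  classical
  rw [quantize_eq_sum]
  exact Submodule.sum_mem _ fun r _ =>
    ⟨r, fun _ _ => quantizeHom_apply_mem_vanishingIdeal cov ħ (Φ r)⟩

variable {ħ}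

theorem neg_I_mul_ofReal_pow_ne_zero (hħ : ħ ≠ 0) (r : ℕ) : (-Complex.I * ħ) ^ r ≠ 0 :=
  pow_ne_zero r (mul_ne_zero (neg_ne_zero.2 Complex.I_ne_zero) (Complex.ofReal_ne_zero.2 hħ))

/-- The leading term `Φ_r` is read off the values of the operator on `r`-th powers of functions
with prescribed differential, since the terms of lower order vanish there. -/
theorem quantize_injective (hħ : ħ ≠ 0) : Function.Injective (quantize (M := M) cov ħ) := by
  classical
  refine (injective_iff_map_eq_zero _).2 fun Φ hΦ => ?_
  by_contra hne
  have hsupport : Φ.support.Nonempty :=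
    Finset.nonempty_iff_ne_empty.2 (mt DFinsupp.support_eq_empty.1 hne)
  have hmem := Φ.support.max'_mem hsupport
  set r := Φ.support.max' hsupport
  refine DFinsupp.mem_support_iff.1 hmem (symTensor_eq_zero_of_diagonal fun x ξ => ?_)
  have hlower : ∀ k ∈ Φ.support, k ≠ r →
      quantizeHom cov ħ k (Φ k) (coordSection n x ξ ^ r) x = 0 := fun k hk hkr => by
    rw [quantizeHom_apply, contractionFunctional_pow_of_lt cov
      ((Φ.support.le_max' k hk).lt_of_ne hkr) _ (coordSection_mem_vanishingIdeal x ξ), mul_zero]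
  have hzero : quantize cov ħ Φ (coordSection n x ξ ^ r) x = 0 := by rw [hΦ]; rfl
  rw [quantize_apply, Finset.sum_eq_single_of_mem r hmem hlower, quantizeHom_apply,
    contractionFunctional_coordSection_pow] at hzero
  exact (mul_eq_zero.1 ((mul_eq_zero.1 hzero).resolve_left
    (neg_I_mul_ofReal_pow_ne_zero hħ r))).resolve_left (Nat.cast_ne_zero.2 r.factorial_ne_zero)

end Quantize

/-! ### The principal symbol -/

section Symbol

variable {n : ℕ} {M : Type*} [TopologicalSpace M] [ChartedSpace (EuclideanSpace ℝ (Fin n)) M]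
  [IsManifold (𝓡 n) ∞ M] [T2Space M] {P : SmoothFun n M →ₗ[ℂ] SmoothFun n M} {r : ℕ} {x : M}

/-- The principal symbol at `x` of an operator `P` of order `r`, multiplied by `c`: its value at
`(df₁, …, df_r)` is `c P(f₁ ⋯ f_r)(x)` for functions `f_i` vanishing at `x`. -/
def symbolForm (P : SmoothFun n M →ₗ[ℂ] SmoothFun n M) (r : ℕ) (c : ℂ) (x : M) :
    MultilinearMap ℝ (fun _ : Fin r => Cotangent n M x) ℂ :=
  ((c • (SmoothFun.eval x).toLinearMap ∘ₗ P).restrictScalars ℝ).compMultilinearMap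
    ((MultilinearMap.mkPiAlgebra ℝ (Fin r) (SmoothFun n M)).compLinearMap
      fun _ => coordSection n x)

theorem symbolForm_apply (P : SmoothFun n M →ₗ[ℂ] SmoothFun n M) (c : ℂ) (x : M)
    (ξ : Fin r → Cotangent n M x) :
    symbolForm P r c x ξ = c * P (∏ i, coordSection n x (ξ i)) x := rfl

theorem sub_coordSection_differential_mem {f : M → ℝ} (hf : ContMDiff (𝓡 n) 𝓘(ℝ, ℝ) ∞ f)
    (x : M) :
    SmoothFun.ofReal f hf - algebraMap ℂ (SmoothFun n M) (f x) -
      coordSection n x (differential n f x) ∈ vanishingIdeal n x ^ 2 := by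
  have hderiv : ∀ v, mvfderiv (𝓡 n) (SmoothFun.ofReal f hf - algebraMap ℂ (SmoothFun n M) (f x) :
      SmoothFun n M) x v = (differential n f x v : ℝ) := fun v => by
    change mvfderiv (𝓡 n) (fun y => (f y : ℂ) - f x) x v = _
    rw [mvfderiv_fun_sub (g := fun y => (f y : ℂ)) ((SmoothFun.ofReal f hf).mdifferentiableAt x)
      mdifferentiableAt_const, mvfderiv_const, sub_zero]
    exact mvfderiv_ofReal_apply ((hf x).mdifferentiableAt (by simp)) v
  have hsection : coordSection n x (differential n f x) = ∑ i,
      ((differential n f x (tangentBasis x i) : ℝ) : ℂ) • coordSection n x (dualBasis x i) := by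
    conv_lhs => rw [eq_sum_dualBasis (differential n f x), map_sum]
    exact Finset.sum_congr rfl fun i _ => map_smul _ _ _
  simp only [hsection, ← hderiv]
  exact sub_sum_coordSection_mem x (sub_algebraMap_mem_vanishingIdeal x (SmoothFun.ofReal f hf))

variable (hP : ∀ x : M, ∀ f ∈ vanishingIdeal n x ^ (r + 1), P f ∈ vanishingIdeal n x)

include hP

omit [IsManifold (𝓡 n) ∞ M] [T2Space M] in
theorem apply_prod_congr {a b : Fin r → SmoothFun n M} (ha : ∀ i, a i ∈ vanishingIdeal n x)
    (hb : ∀ i, b i ∈ vanishingIdeal n x) (hab : ∀ i, a i - b i ∈ vanishingIdeal n x ^ 2) :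
    P (∏ i, a i) x = P (∏ i, b i) x := by
  have h := hP x _ (prod_sub_prod_mem_pow ha hb hab)
  rw [mem_vanishingIdeal, map_sub, SmoothFun.sub_apply] at h
  exact sub_eq_zero.1 h

theorem contMDiff_symbolForm (c : ℂ) {f : Fin r → M → ℝ}
    (hf : ∀ i, ContMDiff (𝓡 n) 𝓘(ℝ, ℝ) ∞ (f i)) :
    ContMDiff (𝓡 n) 𝓘(ℝ, ℂ) ∞ (fun x => symbolForm P r c x fun i => differential n (f i) x) := by
  classical
  let F : Fin r → SmoothFun n M := fun i => SmoothFun.ofReal (f i) (hf i)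
  have hsum : (fun x => symbolForm P r c x fun i => differential n (f i) x) =
      (c • ∑ t ∈ (Finset.univ : Finset (Fin r)).powerset,
        (∏ i ∈ Finset.univ \ t, -F i) * P (∏ i ∈ t, F i) : SmoothFun n M) := by
    funext x
    have hprod : P (∏ i, coordSection n x (differential n (f i) x)) x =
        P (∏ i, (F i + algebraMap ℂ (SmoothFun n M) (-F i x))) x := by
      simp only [map_neg, ← sub_eq_add_neg]
      exact (apply_prod_congr hP (fun i => sub_algebraMap_mem_vanishingIdeal x (F i))
        (fun i => coordSection_mem_vanishingIdeal x _)
        (fun i => sub_coordSection_differential_mem (hf i) x)).symm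
    rw [symbolForm_apply, hprod, Finset.prod_add, map_sum, SmoothFun.sum_apply,
      SmoothFun.smul_apply, SmoothFun.sum_apply]
    refine congrArg (c * ·) (Finset.sum_congr rfl fun t _ => ?_)
    rw [← map_prod, mul_comm, ← Algebra.smul_def, map_smul, SmoothFun.smul_apply,
      SmoothFun.mul_apply, SmoothFun.prod_apply]
    rfl
  exact hsum ▸ SmoothFun.contMDiff _

/-- The principal symbol of an operator `P` of order `r`, multiplied by `c`, as a tensor field. -/
def symbol (c : ℂ) : symTensor n M r :=
  ⟨symbolForm P r c, fun x σ ξ => by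
    rw [symbolForm_apply, symbolForm_apply,
      Equiv.prod_comp σ fun i => coordSection n x (ξ i)], fun _ => contMDiff_symbolForm hP c⟩

theorem apply_pow_eq_sum {g : SmoothFun n M} (hg : g ∈ vanishingIdeal n x) :
    P (g ^ r) x = ∑ i : Fin r → Fin n, (∏ k, mvfderiv (𝓡 n) g x (tangentBasis x (i k))) *
      P (∏ k, coordSection n x (dualBasis x (i k))) x := by
  classical
  have hlinear : ∑ i, mvfderiv (𝓡 n) g x (tangentBasis x i) • coordSection n x (dualBasis x i) ∈
      vanishingIdeal n x :=
    Submodule.sum_mem _ fun i _ => Submodule.smul_of_tower_mem _ _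
      (coordSection_mem_vanishingIdeal x _)
  have hcongr := apply_prod_congr hP (a := fun _ => g) (fun _ => hg) (fun _ => hlinear)
    fun _ => sub_sum_coordSection_mem x hg
  rw [Finset.prod_const, Finset.card_univ, Fintype.card_fin] at hcongr
  simp only [hcongr, Finset.prod_univ_sum, Fintype.piFinset_univ, Finset.prod_smul, map_sum,
    map_smul, SmoothFun.sum_apply, SmoothFun.smul_apply]

variable (cov : LinearConnection n M) [cov.ContMDiffCovariantDerivative ∞] {ħ : ℝ}

theorem sub_quantizeHom_symbol_apply_mem (hħ : ħ ≠ 0) (x : M) {f : SmoothFun n M}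
    (hf : f ∈ vanishingIdeal n x ^ r) :
    (P - quantizeHom cov ħ r (symbol hP ((-Complex.I * ħ) ^ r * r.factorial)⁻¹)) f ∈
      vanishingIdeal n x := by
  set A := symbol hP ((-Complex.I * ħ) ^ r * r.factorial)⁻¹
  have hconst : (-Complex.I * ħ) ^ r * (r.factorial : ℂ) ≠ 0 :=
    mul_ne_zero (neg_I_mul_ofReal_pow_ne_zero hħ r) (Nat.cast_ne_zero.2 r.factorial_ne_zero)
  refine map_eq_zero_of_map_pow_eq_zero
    (L := (SmoothFun.eval x).toLinearMap ∘ₗ (P - quantizeHom cov ħ r A))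
    (fun a => ⟨a x, sub_algebraMap_mem_vanishingIdeal x a⟩) (fun g hg => ?_) (fun f hf =>
      sub_mem (hP x f hf) (quantizeHom_apply_mem_vanishingIdeal cov ħ A hf)) hf
  change P (g ^ r) x - quantizeHom cov ħ r A (g ^ r) x = 0
  rw [quantizeHom_apply, contractionFunctional_pow_self cov A hg, apply_pow_eq_sum hP hg,
    ← mul_assoc, Finset.mul_sum, sub_eq_zero]
  refine Finset.sum_congr rfl fun i _ => ?_
  have hA : A.1 x (fun k => dualBasis x (i k)) = ((-Complex.I * ħ) ^ r * r.factorial)⁻¹ *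
      P (∏ k, coordSection n x (dualBasis x (i k))) x := rfl
  rw [hA, ← mul_assoc, mul_inv_cancel_left₀ hconst, mul_comm]

end Symbol

section DiffOp

variable {n : ℕ} {M : Type*} [TopologicalSpace M] [ChartedSpace (EuclideanSpace ℝ (Fin n)) M]
  [IsManifold (𝓡 n) ∞ M] [T2Space M] (cov : LinearConnection n M)
  [cov.ContMDiffCovariantDerivative ∞] {ħ : ℝ}

theorem exists_quantize_eq (hħ : ħ ≠ 0) (r : ℕ) {P : SmoothFun n M →ₗ[ℂ] SmoothFun n M}
    (hP : ∀ x : M, ∀ f ∈ vanishingIdeal n x ^ r, P f ∈ vanishingIdeal n x) :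
    ∃ Φ : SymTensor n M, quantize cov ħ Φ = P := by
  classical
  induction r generalizing P with
  | zero =>
    refine ⟨0, LinearMap.ext fun f => SmoothFun.ext fun x => ?_⟩
    rw [map_zero]
    exact (hP x f (by simp)).symm
  | succ r ih =>
    obtain ⟨Φ, hΦ⟩ := ih fun x _ => sub_quantizeHom_symbol_apply_mem hP cov hħ x
    refine ⟨Φ + DFinsupp.single r (symbol hP ((-Complex.I * ħ) ^ r * r.factorial)⁻¹), ?_⟩
    rw [map_add, hΦ, quantize, DFinsupp.lsum_single, sub_add_cancel]

theorem mem_diffOp_iff_exists_quantize_eq (hħ : ħ ≠ 0) {P : SmoothFun n M →ₗ[ℂ] SmoothFun n M} :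
    P ∈ diffOp n M ↔ ∃ Φ : SymTensor n M, quantize cov ħ Φ = P :=
  ⟨fun ⟨r, hr⟩ => exists_quantize_eq cov hħ (r + 1) hr,
    fun ⟨Φ, hΦ⟩ => hΦ ▸ quantize_mem_diffOp cov ħ Φ⟩

theorem existsUnique_isQuantized (hħ : ħ ≠ 0) (P : diffOp n M) :
    ∃! Φ : SymTensor n M, IsQuantized ħ cov Φ P.1 := by
  obtain ⟨Φ, hΦ⟩ := (mem_diffOp_iff_exists_quantize_eq cov hħ).1 P.2
  refine ⟨Φ, (isQuantized_iff cov ħ Φ P.1).2 hΦ.symm, fun Ψ hΨ => quantize_injective cov hħ ?_⟩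
  rw [hΦ, ← (isQuantized_iff cov ħ Ψ P.1).1 hΨ]

end DiffOp

/-! ### Fibrewise polynomial functions -/

section FibrewiseSmooth

open Filter Topology

variable {n : ℕ} {M : Type*} [TopologicalSpace M] [ChartedSpace (EuclideanSpace ℝ (Fin n)) M]
  [IsManifold (𝓡 n) ∞ M]

theorem contMDiffAt_apply_coordFrame (p₀ : CotangentBundle n M) (i : Fin n) :
    ContMDiffAt (cotangentModel n) 𝓘(ℝ, ℝ) ∞
      (fun p : CotangentBundle n M => (p.2 (coordFrame n p₀.proj i p.proj) : ℝ)) p₀ := by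
  have hframe : ContMDiffAt (cotangentModel n) ((𝓡 n).prod 𝓘(ℝ, EuclideanSpace ℝ (Fin n))) ∞
      (fun p : CotangentBundle n M =>
        (⟨p.proj, coordFrame n p₀.proj i p.proj⟩ : TangentBundle (𝓡 n) M)) p₀ :=
    (smoothFieldNear_coordFrame p₀.proj i).self_of_nhds.comp p₀
      (Bundle.contMDiff_proj (Cotangent n M) p₀)
  have hpoint : ContMDiffAt (cotangentModel n) (cotangentModel n) ∞
      (fun p : CotangentBundle n M => Bundle.TotalSpace.mk' (EuclideanSpace ℝ (Fin n) →L[ℝ] ℝ)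
        (E := Cotangent n M) p.proj p.2) p₀ := contMDiffAt_id
  exact (Bundle.contMDiffAt_totalSpace.1 (hpoint.clm_bundle_apply hframe)).2

theorem inCoordinates_differential (g : M → ℝ) (x₀ x : M) :
    ContinuousLinearMap.inCoordinates (EuclideanSpace ℝ (Fin n))
      (TangentSpace (𝓡 n) : M → Type) ℝ (Bundle.Trivial M ℝ) x₀ x x₀ x (differential n g x) =
    inTangentCoordinates (𝓡 n) 𝓘(ℝ, ℝ) id g (mfderiv (𝓡 n) 𝓘(ℝ, ℝ) g) x₀ x := by
  simp only [inTangentCoordinates, ContinuousLinearMap.inCoordinates,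
    TangentBundle.continuousLinearMapAt_model_space]
  exact congrArg (fun L : ℝ →L[ℝ] ℝ => L ∘L (differential n g x ∘L _))
    (Bundle.Trivial.continuousLinearMapAt_trivialization ℝ M ℝ x)

theorem contMDiff_differential {g : M → ℝ} (hg : ContMDiff (𝓡 n) 𝓘(ℝ, ℝ) ∞ g) :
    ContMDiff (𝓡 n) (cotangentModel n) ∞
      (fun x => (⟨x, differential n g x⟩ : CotangentBundle n M)) := by
  intro x₀
  refine (contMDiffAt_hom_bundle _).2 ⟨contMDiffAt_id, ?_⟩
  simp only [inCoordinates_differential]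
  exact (hg x₀).mfderiv_const (m := ∞) (by simp)

theorem eventually_eq_sum_differential_coordFun (x₀ : M) :
    ∀ᶠ x in 𝓝 x₀, ∀ ξ : Cotangent n M x,
      ξ = ∑ i, (ξ (coordFrame n x₀ i x) : ℝ) • differential n (coordFun n x₀ i) x := by
  filter_upwards [eventually_eq_sum_coordFrame (n := n) x₀,
    eventually_differential_coordFun (n := n) x₀] with x hframe hdiff ξ
  ext v
  conv_lhs => rw [hframe v, map_sum]
  rw [sum_apply]
  refine Finset.sum_congr rfl fun i _ => ?_
  rw [map_smul, smul_apply, hdiff i v]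
  exact mul_comm _ _

theorem contMDiff_symTensor_diagonal [T2Space M] {r : ℕ} (A : symTensor n M r) :
    ContMDiff (cotangentModel n) 𝓘(ℝ, ℂ) ∞
      (fun p : CotangentBundle n M => A.1 p.proj fun _ => p.2) := by
  intro p₀
  have hproj : ContMDiffAt (cotangentModel n) (𝓡 n) ∞
      (Bundle.TotalSpace.proj : CotangentBundle n M → M) p₀ :=
    Bundle.contMDiff_proj (Cotangent n M) p₀
  have hsum : ContMDiffAt (cotangentModel n) 𝓘(ℝ, ℂ) ∞ (fun p : CotangentBundle n M =>
      ∑ I : Fin r → Fin n, (∏ k, p.2 (coordFrame n p₀.proj (I k) p.proj) : ℝ) •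
        A.1 p.proj fun k => differential n (coordFun n p₀.proj (I k)) p.proj) p₀ :=
    ContMDiffAt.sum fun I _ =>
      (ContMDiffAt.prod fun k _ => contMDiffAt_apply_coordFrame p₀ (I k)).smul
        (ContMDiffAt.comp p₀ (A.2.2 _ (fun k => contMDiff_coordFun p₀.proj (I k)) p₀.proj) hproj)
  refine hsum.congr_of_eventuallyEq ?_
  filter_upwards [hproj.continuousAt.eventually
    (eventually_eq_sum_differential_coordFun (n := n) p₀.proj)] with p hp
  conv_lhs => rw [hp p.2, MultilinearMap.map_sum]
  exact Finset.sum_congr rfl fun I _ => MultilinearMap.map_smul_univ _ _ _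

end FibrewiseSmooth

section FibreFunction

variable {n : ℕ} {M : Type*} [TopologicalSpace M] [ChartedSpace (EuclideanSpace ℝ (Fin n)) M]

/-- The evaluation `Φ ↦ ∑ r, Φ_r(p, …, p)` of the functions of tensor fields at a covector `p`. -/
def fibreEval (p : CotangentBundle n M) : SymTensor n M →ₗ[ℂ] ℂ :=
  DFinsupp.lsum ℂ fun _ =>
    { toFun := fun A => A.1 p.proj fun _ => p.2
      map_add' := fun _ _ => rfl
      map_smul' := fun _ _ => rfl }

theorem fibreEval_eq_fibreFunction (p : CotangentBundle n M) (Φ : SymTensor n M) :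
    fibreEval p Φ = fibreFunction Φ p := by
  classical
  exact DFinsupp.sumAddHom_apply _ Φ

theorem fibreFunction_sub (Φ Ψ : SymTensor n M) (p : CotangentBundle n M) :
    fibreFunction (Φ - Ψ) p = fibreFunction Φ p - fibreFunction Ψ p := by
  simp only [← fibreEval_eq_fibreFunction, map_sub]

theorem fibreFunction_single (r : ℕ) (A : symTensor n M r) (p : CotangentBundle n M) :
    fibreFunction (DFinsupp.single r A) p = A.1 p.proj fun _ => p.2 := by
  rw [← fibreEval_eq_fibreFunction]
  exact DFinsupp.lsum_single _ _ _ _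

open Classical in
theorem fibreFunction_eq_sum_range {Φ : SymTensor n M} {d : ℕ}
    (hd : Φ.support ⊆ Finset.range (d + 1)) (p : CotangentBundle n M) :
    fibreFunction Φ p = ∑ k ∈ Finset.range (d + 1), (Φ k).1 p.proj (fun _ => p.2) := by
  refine Finset.sum_subset hd fun k _ hk => ?_
  rw [DFinsupp.notMem_support_iff.1 hk]
  rfl

open Classical in
theorem exists_support_subset_range (Φ : SymTensor n M) :
    ∃ d : ℕ, Φ.support ⊆ Finset.range (d + 1) := by
  obtain ⟨d, hd⟩ := Φ.support.exists_nat_subset_range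
  exact ⟨d, hd.trans (Finset.range_mono d.le_succ)⟩

theorem isFibrePolynomial_fibreFunction [IsManifold (𝓡 n) ∞ M] [T2Space M] (Φ : SymTensor n M) :
    IsFibrePolynomial (fibreFunction Φ) := by
  obtain ⟨d, hd⟩ := exists_support_subset_range Φ
  refine ⟨?_, d, fun x => ⟨fun k => (Φ k).1 x, fun ξ => fibreFunction_eq_sum_range hd _⟩⟩
  rw [funext (fibreFunction_eq_sum_range hd)]
  exact fun p => ContMDiffAt.sum fun k _ => contMDiff_symTensor_diagonal (Φ k) p

theorem eq_zero_of_fibreFunction_eq_zero {Φ : SymTensor n M} (h : ∀ p, fibreFunction Φ p = 0) :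
    Φ = 0 := by
  classical
  obtain ⟨d, hd⟩ := exists_support_subset_range Φ
  refine DFinsupp.ext fun k => ?_
  by_cases hk : k ∈ Φ.support
  · refine symTensor_eq_zero_of_diagonal fun x ξ => ?_
    rw [diagonal_eq_sum_mul_coeff_basis (A := fun k => (Φ k).1 x)
      (F := fun ξ => fibreFunction Φ ⟨x, ξ⟩) (fun ξ => fibreFunction_eq_sum_range hd ⟨x, ξ⟩)
      (Finset.mem_range_succ_iff.1 (hd hk))]
    simp only [h, zero_mul, Finset.sum_const_zero]
  · exact DFinsupp.notMem_support_iff.1 hk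

variable (n M) in
/-- The tensor field of order zero given by a constant. -/
def constTensor (c : ℂ) : symTensor n M 0 :=
  ⟨fun x => MultilinearMap.constOfIsEmpty ℝ (fun _ : Fin 0 => Cotangent n M x) c,
    fun _ _ _ => rfl, fun _ _ => contMDiff_const⟩

theorem fibreFunction_constTensor (c : ℂ) (p : CotangentBundle n M) :
    fibreFunction (DFinsupp.single 0 (constTensor n M c)) p = c :=
  fibreFunction_single _ _ p

section Quantize

variable [IsManifold (𝓡 n) ∞ M] [T2Space M] (cov : LinearConnection n M)
  [cov.ContMDiffCovariantDerivative ∞] {ħ : ℝ}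

theorem quantize_constTensor (c : ℂ) :
    quantize cov ħ (DFinsupp.single 0 (constTensor n M c)) = c • LinearMap.id := by
  have hsingle : quantize cov ħ (DFinsupp.single 0 (constTensor n M c)) =
      quantizeHom cov ħ 0 (constTensor n M c) := DFinsupp.lsum_single _ _ _ _
  refine LinearMap.ext fun f => SmoothFun.ext fun x => ?_
  rw [hsingle, quantizeHom_apply]
  change _ * contraction _ _ = _
  rw [contraction, pow_zero, one_mul, Fintype.sum_unique, symCovAt, Fintype.sum_unique,
    Nat.factorial_zero, Nat.cast_one, inv_one, one_mul]
  rfl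

theorem forall_fibreFunction_eq_const_iff (hħ : ħ ≠ 0) (Φ : SymTensor n M) (c : ℂ) :
    (∀ p, fibreFunction Φ p = c) ↔ quantize cov ħ Φ = c • LinearMap.id := by
  rw [← quantize_constTensor cov c, (quantize_injective cov hħ).eq_iff]
  constructor
  · intro h
    refine sub_eq_zero.1 (eq_zero_of_fibreFunction_eq_zero fun p => ?_)
    rw [fibreFunction_sub, fibreFunction_constTensor, h, sub_self]
  · rintro rfl p
    exact fibreFunction_constTensor c p

end Quantize

theorem differential_const_mul (t : ℝ) {f : M → ℝ} (hf : ContMDiff (𝓡 n) 𝓘(ℝ, ℝ) ∞ f) (x : M) :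
    differential n (fun y => t * f y) x = t • differential n f x := by
  ext v
  exact mvfderiv_const_mul_apply t ((hf x).mdifferentiableAt (by simp)) v

theorem differential_sum {ι : Type*} (S : Finset ι) {f : ι → M → ℝ}
    (hf : ∀ i, ContMDiff (𝓡 n) 𝓘(ℝ, ℝ) ∞ (f i)) (x : M) :
    differential n (fun y => ∑ i ∈ S, f i y) x = ∑ i ∈ S, differential n (f i) x := by
  classical
  induction S using Finset.induction_on with
  | empty =>
    simp only [Finset.sum_empty]
    exact mvfderiv_const (0 : ℝ)
  | insert a S ha ih =>
    simp only [Finset.sum_insert ha]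
    rw [← ih]
    exact mvfderiv_fun_add ((hf a x).mdifferentiableAt (by simp))
      ((ContMDiffAt.sum fun i _ => hf i x).mdifferentiableAt (n := ∞) (by simp))

theorem mem_symTensor_of_contMDiff_diagonal {k : ℕ}
    {B : ∀ x : M, MultilinearMap ℝ (fun _ : Fin k => Cotangent n M x) ℂ}
    (hsymm : ∀ (x : M) (σ : Equiv.Perm (Fin k)) (ξ : Fin k → Cotangent n M x),
      B x (fun i => ξ (σ i)) = B x ξ)
    (hdiag : ∀ g : M → ℝ, ContMDiff (𝓡 n) 𝓘(ℝ, ℝ) ∞ g →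
      ContMDiff (𝓡 n) 𝓘(ℝ, ℂ) ∞ fun x => B x fun _ => differential n g x) :
    B ∈ symTensor n M k := by
  refine ⟨hsymm, fun f hf => ?_⟩
  have polarized : (fun x => B x fun i => differential n (f i) x) = (k.factorial : ℂ)⁻¹ •
      ∑ S : Finset (Fin k), (-1 : ℤ) ^ Sᶜ.card •
        fun x => B x fun _ => differential n (fun y => ∑ i ∈ S, f i y) x := by
    funext x
    have h := polarization (B x) (hsymm x) fun i => differential n (f i) x
    rw [Fintype.card_fin, nsmul_eq_mul] at h
    simp only [Pi.smul_apply, Finset.sum_apply, differential_sum _ hf, h, smul_eq_mul]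
    rw [inv_mul_cancel_left₀ (Nat.cast_ne_zero.2 k.factorial_ne_zero)]
  rw [polarized]
  exact (smoothFunctions n M).smul_mem (sum_mem fun S _ => zsmul_mem
    (hdiag _ fun y => ContMDiffAt.sum fun i _ => hf i y) _) _

theorem symmetrize_mem_symTensor [IsManifold (𝓡 n) ∞ M] {F : CotangentBundle n M → ℂ}
    (hF : ContMDiff (cotangentModel n) 𝓘(ℝ, ℂ) ∞ F)
    {A : ∀ (x : M) (k : ℕ), MultilinearMap ℝ (fun _ : Fin k => Cotangent n M x) ℂ} {d k : ℕ}
    (hA : ∀ x ξ, F ⟨x, ξ⟩ = ∑ j ∈ Finset.range (d + 1), A x j (fun _ => ξ)) (hk : k ≤ d) :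
    (fun x => symmetrize (A x k)) ∈ symTensor n M k := by
  refine mem_symTensor_of_contMDiff_diagonal (fun x => symmetrize_perm (A x k)) fun g hg => ?_
  have extracted : (fun x => symmetrize (A x k) fun _ => differential n g x) =
      ∑ t ∈ Finset.range (d + 1),
        (Lagrange.basis (Finset.range (d + 1)) (Nat.cast : ℕ → ℂ) t).coeff k •
          fun x => F ⟨x, differential n (fun y => (t : ℝ) * g y) x⟩ := by
    funext x
    rw [symmetrize_diagonal, diagonal_eq_sum_mul_coeff_basis (hA x) hk]
    simp only [Finset.sum_apply, Pi.smul_apply, differential_const_mul _ hg, smul_eq_mul]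
    exact Finset.sum_congr rfl fun t _ => mul_comm _ _
  rw [extracted]
  exact sum_mem fun t _ => (smoothFunctions n M).smul_mem
    (hF.comp (contMDiff_differential (contMDiff_const.mul hg))) _

theorem exists_fibreFunction_eq [IsManifold (𝓡 n) ∞ M] {F : CotangentBundle n M → ℂ}
    (hF : IsFibrePolynomial F) : ∃ Φ : SymTensor n M, fibreFunction Φ = F := by
  classical
  obtain ⟨hsmooth, d, hA⟩ := hF
  choose A hA using hA
  let Φ : SymTensor n M := DFinsupp.mk (Finset.range (d + 1)) fun k =>
    ⟨_, symmetrize_mem_symTensor hsmooth hA (Finset.mem_range_succ_iff.1 k.2)⟩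
  refine ⟨Φ, funext fun p => ?_⟩
  rw [fibreFunction_eq_sum_range DFinsupp.support_mk_subset]
  refine (Finset.sum_congr rfl fun k hk => ?_).trans (hA p.proj p.2).symm
  rw [show Φ k = _ from DFinsupp.mk_of_mem hk]
  exact symmetrize_diagonal _ _

end FibreFunction

/-! ### The symplectic form in a chart -/

section SymplecticForm

open Filter Topology

theorem mdifferentiableAt_extChartAt_symm {E H N : Type*} [NormedAddCommGroup E] [NormedSpace ℝ E]
    [TopologicalSpace H] {J : ModelWithCorners ℝ E H} [J.Boundaryless] [TopologicalSpace N]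
    [ChartedSpace H N] [IsManifold J 1 N] {p : N} {z : E} (hz : z ∈ (extChartAt J p).target) :
    MDifferentiableAt 𝓘(ℝ, E) J (extChartAt J p).symm z :=
  ((contMDiffOn_extChartAt_symm (n := 1) p).contMDiffAt
    ((isOpen_extChartAt_target p).mem_nhds hz)).mdifferentiableAt one_ne_zero

variable {n : ℕ} {M : Type*} [TopologicalSpace M] [ChartedSpace (EuclideanSpace ℝ (Fin n)) M]
  [IsManifold (𝓡 n) ∞ M]

theorem extChartAt_cotangent_snd (p q : CotangentBundle n M) :
    (extChartAt (cotangentModel n) p q).2 = (q.2 : TangentSpace (𝓡 n) q.proj →L[ℝ] ℝ) ∘L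
      (trivializationAt (EuclideanSpace ℝ (Fin n)) (TangentSpace (𝓡 n) : M → Type)
        p.proj).symmL ℝ q.proj := by
  rw [FiberBundle.extChartAt]
  exact congrArg (fun L : ℝ →L[ℝ] ℝ => L ∘L (q.2 ∘L _))
    (Bundle.Trivial.continuousLinearMapAt_trivialization ℝ M ℝ q.proj)

variable (p : CotangentBundle n M) {z : CotangentModel n}
  (hz : z ∈ (extChartAt (cotangentModel n) p).target)

include hz

theorem proj_extChartAt_symm :
    ((extChartAt (cotangentModel n) p).symm z).proj = (extChartAt (𝓡 n) p.proj).symm z.1 := by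
  rw [FiberBundle.extChartAt_target] at hz
  rw [FiberBundle.extChartAt]
  exact (trivializationAt (EuclideanSpace ℝ (Fin n) →L[ℝ] ℝ) (Cotangent n M)
    p.proj).proj_symm_apply' hz.1.2

theorem fst_mem_extChartAt_target : z.1 ∈ (extChartAt (𝓡 n) p.proj).target := by
  rw [FiberBundle.extChartAt_target] at hz
  exact hz.1.1

theorem snd_extChartAt_symm_comp_mfderiv :
    (((extChartAt (cotangentModel n) p).symm z).2 :
        TangentSpace (𝓡 n) ((extChartAt (cotangentModel n) p).symm z).proj →L[ℝ] ℝ) ∘L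
      mfderiv 𝓘(ℝ, EuclideanSpace ℝ (Fin n)) (𝓡 n) (extChartAt (𝓡 n) p.proj).symm z.1 = z.2 := by
  set q := (extChartAt (cotangentModel n) p).symm z with hq
  have hz₁ := fst_mem_extChartAt_target p hz
  have hproj : q.proj = (extChartAt (𝓡 n) p.proj).symm z.1 := proj_extChartAt_symm p hz
  have hsource : q.proj ∈ (chartAt (EuclideanSpace ℝ (Fin n)) p.proj).source := by
    rw [hproj, ← extChartAt_source (𝓡 n)]
    exact (extChartAt (𝓡 n) p.proj).map_target hz₁
  have hsnd : z.2 = (q.2 : TangentSpace (𝓡 n) q.proj →L[ℝ] ℝ) ∘L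
      (trivializationAt (EuclideanSpace ℝ (Fin n)) (TangentSpace (𝓡 n) : M → Type)
        p.proj).symmL ℝ q.proj := by
    rw [← extChartAt_cotangent_snd, hq, (extChartAt (cotangentModel n) p).right_inv hz]
  have hchart : extChartAt (𝓡 n) p.proj q.proj = z.1 := by
    rw [hproj, (extChartAt (𝓡 n) p.proj).right_inv hz₁]
  rw [TangentBundle.symmL_trivializationAt hsource, hchart, ModelWithCorners.range_eq_univ,
    mfderivWithin_univ] at hsnd
  exact hsnd.symm

theorem mfderiv_proj_mfderiv_extChartAt_symm (w : CotangentModel n) :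
    mfderiv (cotangentModel n) (𝓡 n) (Bundle.TotalSpace.proj : CotangentBundle n M → M)
        ((extChartAt (cotangentModel n) p).symm z)
        (mfderiv 𝓘(ℝ, CotangentModel n) (cotangentModel n)
          (extChartAt (cotangentModel n) p).symm z w) =
      mfderiv 𝓘(ℝ, EuclideanSpace ℝ (Fin n)) (𝓡 n) (extChartAt (𝓡 n) p.proj).symm z.1 w.1 := by
  have hproj : MDifferentiableAt (cotangentModel n) (𝓡 n)
      (Bundle.TotalSpace.proj : CotangentBundle n M → M)
      ((extChartAt (cotangentModel n) p).symm z) :=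
    (Bundle.contMDiff_proj (n := ∞) (Cotangent n M) _).mdifferentiableAt (by simp)
  have hfst : HasMFDerivAt 𝓘(ℝ, CotangentModel n) 𝓘(ℝ, EuclideanSpace ℝ (Fin n))
      Prod.fst z (ContinuousLinearMap.fst ℝ (EuclideanSpace ℝ (Fin n))
        (EuclideanSpace ℝ (Fin n) →L[ℝ] ℝ)) :=
    hasFDerivAt_fst.hasMFDerivAt
  have hcomm : (Bundle.TotalSpace.proj : CotangentBundle n M → M) ∘
      (extChartAt (cotangentModel n) p).symm =ᶠ[𝓝 z]
        (extChartAt (𝓡 n) p.proj).symm ∘ Prod.fst := by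
    filter_upwards [(isOpen_extChartAt_target p).mem_nhds hz] with y hy
    exact proj_extChartAt_symm p hy
  have hbundle := hproj.hasMFDerivAt.comp z (mdifferentiableAt_extChartAt_symm hz).hasMFDerivAt
  have hbase := (mdifferentiableAt_extChartAt_symm
    (fst_mem_extChartAt_target p hz)).hasMFDerivAt.comp z hfst
  exact congrArg (fun L => L w) (hasMFDerivAt_unique (hbundle.congr_of_eventuallyEq hcomm.symm)
    hbase)

theorem liouville_mfderiv_extChartAt_symm (w : CotangentModel n) :
    liouville ((extChartAt (cotangentModel n) p).symm z)
      (mfderiv 𝓘(ℝ, CotangentModel n) (cotangentModel n)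
        (extChartAt (cotangentModel n) p).symm z w) = z.2 w.1 :=
  (congrArg ((extChartAt (cotangentModel n) p).symm z).2
    (mfderiv_proj_mfderiv_extChartAt_symm p hz w)).trans
    (congrArg (fun L => L w.1) (snd_extChartAt_symm_comp_mfderiv p hz))

omit hz

theorem symplecticForm_apply (v w : CotangentModel n) :
    symplecticForm p v w = v.2 w.1 - w.2 v.1 := by
  let B : CotangentModel n →L[ℝ] CotangentModel n →L[ℝ] ℝ :=
    ((ContinuousLinearMap.compL ℝ (CotangentModel n) (EuclideanSpace ℝ (Fin n)) ℝ).flip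
      (ContinuousLinearMap.fst ℝ _ _)).comp (ContinuousLinearMap.snd ℝ _ _)
  have hlocal : (fun z => (liouville ((extChartAt (cotangentModel n) p).symm z)).comp
      (mfderiv 𝓘(ℝ, CotangentModel n) (cotangentModel n)
        (extChartAt (cotangentModel n) p).symm z)) =ᶠ[𝓝 (extChartAt (cotangentModel n) p p)] B := by
    filter_upwards [extChartAt_target_mem_nhds (I := cotangentModel n) p] with z hz
    exact ContinuousLinearMap.ext fun w => liouville_mfderiv_extChartAt_symm p hz w
  have hfderiv := hlocal.fderiv_eq (𝕜 := ℝ)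
  rw [B.fderiv] at hfderiv
  have antisymmetrize : ∀ (A : CotangentModel n →L[ℝ] CotangentModel n →L[ℝ] ℝ)
      (φ : CotangentModel n → CotangentModel n), A = B → (∀ v, φ v = v) →
      A (φ v) (φ w) - A (φ w) (φ v) = v.2 w.1 - w.2 v.1 := by
    rintro A φ rfl hφ
    rw [hφ, hφ]
    rfl
  exact antisymmetrize _ _ hfderiv fun v =>
    congrArg (fun L => L v) (mfderiv_extChartAt_self (I := cotangentModel n) (x := p))

theorem symplecticForm_separatingLeft : (symplecticForm p).SeparatingLeft := by
  intro v h
  obtain ⟨v', rfl⟩ : ∃ v' : CotangentModel n, v' = v := ⟨v, rfl⟩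
  have h' (w : CotangentModel n) : v'.2 w.1 - w.2 v'.1 = 0 :=
    (symplecticForm_apply p v' w).symm.trans (h w)
  have hfst : v'.1 = 0 := by
    ext i
    simpa using h' (0, EuclideanSpace.proj i)
  have hsnd : v'.2 = 0 := ContinuousLinearMap.ext fun u => by simpa using h' (u, 0)
  exact Prod.ext hfst hsnd

end SymplecticForm

/-! ### Hamiltonian fields -/

section ComplexTensor

variable {V : Type*} [AddCommGroup V] [Module ℝ V]

theorem exists_eq_one_tmul_add_I_tmul (z : ℂ ⊗[ℝ] V) :
    ∃ a b : V, z = (1 : ℂ) ⊗ₜ[ℝ] a + Complex.I ⊗ₜ[ℝ] b := by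
  induction z using TensorProduct.induction_on with
  | zero => exact ⟨0, 0, by simp⟩
  | tmul c v =>
    refine ⟨c.re • v, c.im • v, ?_⟩
    rw [← TensorProduct.smul_tmul, ← TensorProduct.smul_tmul, ← TensorProduct.add_tmul]
    congr 1
    apply Complex.ext <;> simp
  | add y z hy hz =>
    obtain ⟨a, b, rfl⟩ := hy
    obtain ⟨a', b', rfl⟩ := hz
    exact ⟨a + a', b + b', by rw [TensorProduct.tmul_add, TensorProduct.tmul_add]; abel⟩

theorem rid_baseChange_one_tmul_add_I_tmul (l : V →ₗ[ℝ] ℝ) (a b : V) :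
    TensorProduct.rid ℝ ℂ (l.baseChange ℂ ((1 : ℂ) ⊗ₜ[ℝ] a + Complex.I ⊗ₜ[ℝ] b)) =
      (l a : ℂ) + l b * Complex.I := by
  rw [map_add, map_add, LinearMap.baseChange_tmul, LinearMap.baseChange_tmul,
    TensorProduct.rid_tmul, TensorProduct.rid_tmul, Complex.real_smul, Complex.real_smul, mul_one]

theorem existsUnique_rid_baseChange_flip_eq [FiniteDimensional ℝ V] {β : V →ₗ[ℝ] V →ₗ[ℝ] ℝ}
    (hβ : β.SeparatingLeft) (L : V →ₗ[ℝ] ℂ) :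
    ∃! z : ℂ ⊗[ℝ] V, ∀ w, TensorProduct.rid ℝ ℂ ((β.flip w).baseChange ℂ z) = L w := by
  have injective : Function.Injective β :=
    LinearMap.ker_eq_bot.1 (LinearMap.separatingLeft_iff_ker_eq_bot.1 hβ)
  have surjective : Function.Surjective β :=
    (LinearMap.injective_iff_surjective_of_finrank_eq_finrank
      (Subspace.dual_finrank_eq (K := ℝ) (V := V)).symm).1 injective
  obtain ⟨a, ha⟩ := surjective (Complex.reLm ∘ₗ L)
  obtain ⟨b, hb⟩ := surjective (Complex.imLm ∘ₗ L)
  refine ⟨(1 : ℂ) ⊗ₜ[ℝ] a + Complex.I ⊗ₜ[ℝ] b, fun w => ?_, fun z hz => ?_⟩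
  · rw [rid_baseChange_one_tmul_add_I_tmul, LinearMap.flip_apply, LinearMap.flip_apply, ha, hb]
    exact Complex.re_add_im (L w)
  · obtain ⟨a', b', rfl⟩ := exists_eq_one_tmul_add_I_tmul z
    have re_add_im (w : V) : (β a' w : ℂ) + β b' w * Complex.I = L w := by
      rw [← hz, rid_baseChange_one_tmul_add_I_tmul, LinearMap.flip_apply, LinearMap.flip_apply]
    have re_eq : a' = a := injective <| ha ▸ LinearMap.ext fun w => by
      simpa using congrArg Complex.re (re_add_im w)
    have im_eq : b' = b := injective <| hb ▸ LinearMap.ext fun w => by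
      simpa using congrArg Complex.im (re_add_im w)
    rw [re_eq, im_eq]

end ComplexTensor

section LocallyConstant

open Filter Topology

variable {E H N V : Type*} [NormedAddCommGroup E] [NormedSpace ℝ E] [TopologicalSpace H]
  {J : ModelWithCorners ℝ E H} [J.Boundaryless] [TopologicalSpace N] [ChartedSpace H N]
  [IsManifold J 1 N] [NormedAddCommGroup V] [NormedSpace ℝ V] {F : N → V}

theorem hasFDerivAt_comp_extChartAt_symm_of_mvfderiv_eq_zero (hF : MDifferentiable J 𝓘(ℝ, V) F)
    (hzero : ∀ p, mvfderiv J F p = 0) {p : N} {z : E} (hz : z ∈ (extChartAt J p).target) :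
    HasFDerivAt (F ∘ (extChartAt J p).symm) (0 : E →L[ℝ] V) z := by
  have hcomp := (hF ((extChartAt J p).symm z)).hasMFDerivAt.comp z
    (mdifferentiableAt_extChartAt_symm hz).hasMFDerivAt
  refine hcomp.hasFDerivAt.congr_fderiv (ContinuousLinearMap.ext fun v => ?_)
  exact congrArg (fun L => L (mfderiv 𝓘(ℝ, E) J (extChartAt J p).symm z v))
    (hzero ((extChartAt J p).symm z))

theorem isLocallyConstant_of_mvfderiv_eq_zero (hF : MDifferentiable J 𝓘(ℝ, V) F)
    (hzero : ∀ p, mvfderiv J F p = 0) : IsLocallyConstant F := by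
  rw [IsLocallyConstant.iff_eventually_eq]
  intro p
  obtain ⟨ε, hε, hball⟩ := Metric.isOpen_iff.1 (isOpen_extChartAt_target (I := J) p) _
    (mem_extChartAt_target (I := J) p)
  have hderiv : ∀ z ∈ Metric.ball (extChartAt J p p) ε,
      HasFDerivAt (F ∘ (extChartAt J p).symm) (0 : E →L[ℝ] V) z := fun z hz =>
    hasFDerivAt_comp_extChartAt_symm_of_mvfderiv_eq_zero hF hzero (hball hz)
  filter_upwards [extChartAt_source_mem_nhds (I := J) p, (continuousAt_extChartAt (I := J)
    p).eventually (Metric.ball_mem_nhds _ hε)] with q hsource hq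
  have hconst := Metric.isOpen_ball.is_const_of_fderiv_eq_zero
    (convex_ball (extChartAt J p p) ε).isPreconnected
    (fun z hz => (hderiv z hz).differentiableAt.differentiableWithinAt)
    (fun z hz => (hderiv z hz).fderiv) hq (Metric.mem_ball_self hε)
  rwa [Function.comp_apply, Function.comp_apply, (extChartAt J p).left_inv hsource,
    extChartAt_to_inv] at hconst

end LocallyConstant

theorem preconnectedSpace_totalSpace {B F : Type*} {E : B → Type*} [TopologicalSpace B]
    [TopologicalSpace F] [∀ b, TopologicalSpace (E b)]
    [TopologicalSpace (Bundle.TotalSpace F E)] [FiberBundle F E] [Nonempty F] [PreconnectedSpace B]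
    [∀ b, ConnectedSpace (E b)] : PreconnectedSpace (Bundle.TotalSpace F E) := by
  have connected_fibers (b : B) : IsConnected (Bundle.TotalSpace.proj (F := F) (E := E) ⁻¹' {b}) :=
    Bundle.TotalSpace.range_mk (F := F) (E := E) b ▸
      isConnected_range (FiberBundle.continuous_totalSpaceMk F E b)
  refine preconnectedSpace_iff_connectedComponent.2 fun p => ?_
  rw [← (FiberBundle.isQuotientMap_proj F E).isCoinducing.preimage_connectedComponent
    connected_fibers, PreconnectedSpace.connectedComponent_eq_univ, Set.preimage_univ]

variable {n : ℕ} {M : Type*} [TopologicalSpace M] [ChartedSpace (EuclideanSpace ℝ (Fin n)) M]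
  [IsManifold (𝓡 n) ∞ M]

theorem existsUnique_isHamiltonianField (F : CotangentBundle n M → ℂ) :
    ∃! D : ComplexField n M, IsHamiltonianField F D := by
  have finiteDimensional (p : CotangentBundle n M) :
      FiniteDimensional ℝ (TangentSpace (cotangentModel n) p) :=
    inferInstanceAs (FiniteDimensional ℝ (CotangentModel n))
  choose D hD hunique using fun p : CotangentBundle n M =>
    existsUnique_rid_baseChange_flip_eq (symplecticForm_separatingLeft p)
      (-(mvfderiv (cotangentModel n) F p).toLinearMap)
  refine ⟨D, fun p w => ?_, fun D' hD' => funext fun p => hunique p (D' p) fun w => ?_⟩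
  · exact (congrArg (· + mvfderiv (cotangentModel n) F p w) (hD p w)).trans (neg_add_cancel _)
  · exact eq_neg_of_add_eq_zero_left (hD' p w)

theorem isHamiltonianField_iff_mvfderiv_eq {F G : CotangentBundle n M → ℂ} {D : ComplexField n M}
    (hD : IsHamiltonianField F D) : IsHamiltonianField G D ↔
      ∀ p, mvfderiv (cotangentModel n) F p = mvfderiv (cotangentModel n) G p :=
  ⟨fun h p => ContinuousLinearMap.ext fun w => add_left_cancel ((hD p w).trans (h p w).symm),
    fun h p w => h p ▸ hD p w⟩

theorem isHamiltonianField_iff_exists_sub_eq_const [PreconnectedSpace M]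
    {F G : CotangentBundle n M → ℂ} (hF : MDifferentiable (cotangentModel n) 𝓘(ℝ, ℂ) F)
    (hG : MDifferentiable (cotangentModel n) 𝓘(ℝ, ℂ) G) {D : ComplexField n M}
    (hD : IsHamiltonianField F D) :
    IsHamiltonianField G D ↔ ∃ c : ℂ, ∀ p, F p - G p = c := by
  have mvfderiv_sub_eq (p : CotangentBundle n M) : mvfderiv (cotangentModel n) (F - G) p =
      mvfderiv (cotangentModel n) F p - mvfderiv (cotangentModel n) G p :=
    mvfderiv_sub (hF p) (hG p)
  simp_rw [isHamiltonianField_iff_mvfderiv_eq hD, ← sub_eq_zero (b := mvfderiv _ G _),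
    ← mvfderiv_sub_eq]
  constructor
  · intro hzero
    have connectedFiber (x : M) : ConnectedSpace (Cotangent n M x) :=
      inferInstanceAs (ConnectedSpace (EuclideanSpace ℝ (Fin n) →L[ℝ] ℝ))
    have preconnected : PreconnectedSpace (CotangentBundle n M) := preconnectedSpace_totalSpace
    have locallyConstant : IsLocallyConstant (F - G) :=
      isLocallyConstant_of_mvfderiv_eq_zero (hF.sub hG) hzero
    exact locallyConstant.exists_eq_const.imp fun c hc => congrFun hc
  · rintro ⟨c, hc⟩ p
    rw [show F - G = fun _ => c from funext hc, mvfderiv_const]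

/-! ### Differential operators modulo constants -/

section Correspondence

variable {n : ℕ} {M : Type*} [TopologicalSpace M] [T2Space M]
  [ChartedSpace (EuclideanSpace ℝ (Fin n)) M] [IsManifold (𝓡 n) ∞ M]

omit [T2Space M] [IsManifold (𝓡 n) ∞ M] in
theorem mem_constantOp_iff (P : diffOp n M) :
    P ∈ constantOp n M ↔ ∃ c : ℂ, P.1 = c • LinearMap.id :=
  Submodule.mem_span_singleton.trans (exists_congr fun _ => eq_comm)

variable (cov : LinearConnection n M) [cov.ContMDiffCovariantDerivative ∞] {ħ : ℝ} (hħ : ħ ≠ 0)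

include hħ

theorem existsUnique_isAssociatedField (P : diffOp n M) :
    ∃! D : polynomialHamiltonianFields n M, IsAssociatedField ħ cov P.1 D.1 := by
  obtain ⟨Φ, hΦ, hΦ_unique⟩ := existsUnique_isQuantized cov hħ P
  obtain ⟨D, hD, hD_unique⟩ := existsUnique_isHamiltonianField (fibreFunction Φ)
  refine ⟨⟨D, fibreFunction Φ, isFibrePolynomial_fibreFunction Φ, hD⟩, ⟨Φ, hΦ, hD⟩, ?_⟩
  rintro D' ⟨Ψ, hΨ, hD'⟩
  rw [hΦ_unique Ψ hΨ] at hD'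
  exact Subtype.ext (hD_unique _ hD')

/-- The Hamiltonian field `D_P` associated with a differential operator `P`. -/
def associatedField (P : diffOp n M) : polynomialHamiltonianFields n M :=
  (existsUnique_isAssociatedField cov hħ P).choose

theorem associatedField_eq_iff (P : diffOp n M) (D : polynomialHamiltonianFields n M) :
    associatedField cov hħ P = D ↔ IsAssociatedField ħ cov P.1 D.1 := by
  obtain ⟨hP, hunique⟩ := (existsUnique_isAssociatedField cov hħ P).choose_spec
  exact ⟨fun h => h ▸ hP, fun hD => (hunique D hD).symm⟩

theorem associatedField_surjective : Function.Surjective (associatedField (M := M) cov hħ) := by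
  rintro ⟨D, F, hF, hD⟩
  obtain ⟨Φ, rfl⟩ := exists_fibreFunction_eq hF
  exact ⟨⟨quantize cov ħ Φ, quantize_mem_diffOp cov ħ Φ⟩, (associatedField_eq_iff cov hħ _ _).2
    ⟨Φ, (isQuantized_iff cov ħ Φ _).2 rfl, hD⟩⟩

theorem isAssociatedField_iff_isHamiltonianField {Φ : SymTensor n M} {P : diffOp n M}
    (hΦ : IsQuantized ħ cov Φ P.1) (D : ComplexField n M) :
    IsAssociatedField ħ cov P.1 D ↔ IsHamiltonianField (fibreFunction Φ) D := by
  refine ⟨?_, fun hD => ⟨Φ, hΦ, hD⟩⟩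
  rintro ⟨Ψ, hΨ, hD⟩
  rwa [(existsUnique_isQuantized cov hħ P).unique hΦ hΨ]

theorem associatedField_eq_associatedField_iff [PreconnectedSpace M] (P Q : diffOp n M) :
    associatedField cov hħ P = associatedField cov hħ Q ↔ P - Q ∈ constantOp n M := by
  obtain ⟨Φ, hΦ, hD⟩ := (associatedField_eq_iff cov hħ P _).1 rfl
  obtain ⟨Ψ, hΨ, -⟩ := existsUnique_isQuantized cov hħ Q
  have sub_eq : (P - Q).1 = quantize cov ħ (Φ - Ψ) := by
    rw [map_sub, ← (isQuantized_iff cov ħ Φ P.1).1 hΦ, ← (isQuantized_iff cov ħ Ψ Q.1).1 hΨ]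
    rfl
  have mdifferentiable (Θ : SymTensor n M) :
      MDifferentiable (cotangentModel n) 𝓘(ℝ, ℂ) (fibreFunction Θ) :=
    (isFibrePolynomial_fibreFunction Θ).1.mdifferentiable (by simp)
  rw [eq_comm, associatedField_eq_iff, isAssociatedField_iff_isHamiltonianField cov hħ hΨ,
    isHamiltonianField_iff_exists_sub_eq_const (mdifferentiable Φ) (mdifferentiable Ψ) hD,
    mem_constantOp_iff, sub_eq]
  simp only [← forall_fibreFunction_eq_const_iff cov hħ, fibreFunction_sub]

/-- The bijection induced by `P ↦ D_P` between the differential operators modulo constants and the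
infinitesimal canonical transformations that are polynomial along the fibres. -/
def quotientEquiv [PreconnectedSpace M] :
    (diffOp n M ⧸ constantOp n M) ≃ polynomialHamiltonianFields n M :=
  (Quotient.congrRight fun P Q => (Submodule.quotientRel_def _).trans
    (associatedField_eq_associatedField_iff cov hħ P Q).symm).trans
    (Setoid.quotientKerEquivOfSurjective (associatedField cov hħ)
      (associatedField_surjective cov hħ))

theorem quotientEquiv_mk [PreconnectedSpace M] (P : diffOp n M) :
    quotientEquiv cov hħ (Submodule.Quotient.mk P) = associatedField cov hħ P :=
  rfl

end Correspondence

end Quantization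

end

theorem mainTheorem3_general (n : ℕ) (M : Type*) [TopologicalSpace M] [T2Space M]
    [PreconnectedSpace M] [ChartedSpace (EuclideanSpace ℝ (Fin n)) M] [IsManifold (𝓡 n) ∞ M]
    (cov : Quantization.LinearConnection n M) [cov.ContMDiffCovariantDerivative ∞]
    (ħ : ℝ) (hħ : ħ ≠ 0) :
    (∀ P : Quantization.diffOp n M,
      ∃! Φ : Quantization.SymTensor n M, Quantization.IsQuantized ħ cov Φ P.1) ∧
    ∃ e : (Quantization.diffOp n M ⧸ Quantization.constantOp n M) ≃
        Quantization.polynomialHamiltonianFields n M,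
      ∀ (P : Quantization.diffOp n M) (D : Quantization.polynomialHamiltonianFields n M),
        e (Submodule.Quotient.mk P) = D ↔ Quantization.IsAssociatedField ħ cov P.1 D.1 := by
  refine ⟨Quantization.existsUnique_isQuantized cov hħ, Quantization.quotientEquiv cov hħ,
    fun P D => ?_⟩
  rw [Quantization.quotientEquiv_mk, Quantization.associatedField_eq_iff]

theorem mainTheorem3 (n : ℕ) (M : Type*) [TopologicalSpace M] [T2Space M] [ConnectedSpace M]
    [ChartedSpace (EuclideanSpace ℝ (Fin n)) M] [IsManifold (𝓡 n) ∞ M]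
    (cov : Quantization.LinearConnection n M) [cov.ContMDiffCovariantDerivative ∞]
    (hcov : cov.torsion = 0) (ħ : ℝ) (hħ : ħ ≠ 0) :
    (∀ P : Quantization.diffOp n M,
      ∃! Φ : Quantization.SymTensor n M, Quantization.IsQuantized ħ cov Φ P.1) ∧
    ∃ e : (Quantization.diffOp n M ⧸ Quantization.constantOp n M) ≃
        Quantization.polynomialHamiltonianFields n M,
      ∀ (P : Quantization.diffOp n M) (D : Quantization.polynomialHamiltonianFields n M),
        e (Submodule.Quotient.mk P) = D ↔ Quantization.IsAssociatedField ħ cov P.1 D.1 :=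
  mainTheorem3_general n M cov ħ hħ
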